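/- **Setting.** Let $\alpha$ be a finite measure on $\mathcal B(\mathbb R)$ with distribution function $A$. For a measure $\nu$ on $\mathbb R\times(0,\infty)$, an increasing additive process (IAP) with Poisson intensity $\nu$, defined on a probability space $(\Omega,\mathcal F,P)$, is a real process $L=\{L(x):x\in\mathbb R\}$ with independent increments and a.s. nondecreasing right-continuous paths with $\lim_{x\to-\infty}L(x)=0$, such that $E[e^{-\lambda L(x)}]=\exp\{-\int_{(-\infty,x]\times(0,\infty)}(1-e^{-\lambda v})\,\nu(ds\,dv)\}$, with finite exponent, for all $x\in\mathbb R$, $\lambda\ge 0$. It is a *gamma process* $\Gamma_A$ if $\nu(dx\,dv)=e^{-v}v^{-1}\,dv\,\alpha(dx)$, and an *extended gamma process* $\Gamma_A^\beta$ if $\nu(dx\,dv)=e^{-\beta(x)v}v^{-1}\,dv\,\alpha(dx)$, where $\beta\ge 0$ is measurable (for $\beta=1/c$ with $c\ge 0$ we put $e^{-v/0}=0$). Let $k:\mathbb R\times\mathbb R\to[0,\infty)$ be such that $k(t,\cdot)$ is measurable for every $t$, $k(\cdot,x)$ is nondecreasing and right-continuous with $\lim_{t\to-\infty}k(t,x)=0$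 and with a finite limit $\bar k(x):=\lim_{t\to+\infty}k(t,x)$ for every $x$; let $\int[1-e^{-\lambda v\bar k(x)}]\,\nu(dx\,dv)<\infty$ for every $\lambda>0$ and $\nu(\{(x,v):\bar k(x)>0\})=\infty$. (We say that $k$ is admissible for $\nu$.) The normalized random distribution function (d.f.) driven by $L$ with kernel $k$ is $F(t)=\int k(t,x)\,dL(x)\big/\int\bar k(x)\,dL(x)$, $t\in\mathbb R$. A Dirichlet random d.f. $\mathcal D_A$ is a process whose paths are a.s. probability d.f.s and whose induced random probabilities of the cells $B_1,\dots,B_n$ of any finite measurable partition of $\mathbb R$ have the Dirichlet distribution with parameters $\alpha(B_1),\dots,\alpha(B_n)$. A mixture of a Dirichlet process (MDP) is a random d.f. $t\mapsto\int K(t,x)\,d\mathcal D_A(x)$, where $K(\cdot,x)$ is a probability d.f. for each $x$ and $K(t,\cdot)$ is measurable for each $t$. In each of the following parts "$X$ can be represented as $Y$" means: there is, on the probability space of $X$, a process of the kind used in $Y$ (gamma, extended gamma, Dirichlet) for which $X=Y$ a.s. (for processes: a.s. simultaneously for all $t$); and for every process of that kind, on any probability space, $X$ and $Y$ have the same law.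 **Proposition 3.** (i) Let $L=\Gamma_A^\beta$ be an extended gamma process with $\beta:\mathbb R\to[0,\infty)$, and let $k$ be admissible for its intensity. Then $k/\beta$ (set equal to $0$ on the $\alpha$-null set $\{\beta=0\}$) is admissible for the intensity of $\Gamma_A$, its limit as $t\to+\infty$ is $\bar k/\beta$, and $F$ can be represented as the normalized gamma driven random d.f. with kernel $k/\beta$: $$\frac{\int k(t,x)\,d\Gamma_A^\beta(x)}{\int\bar k(x)\,d\Gamma_A^\beta(x)}=\frac{\int k(t,x)\beta(x)^{-1}\,d\Gamma_A(x)}{\int\bar k(x)\beta(x)^{-1}\,d\Gamma_A(x)},$$ both denominators being a.s. positive and finite. (ii) Let $L=\Gamma_A$ be a gamma process and $k$ admissible for its intensity. Then $0<\int\bar k\,d\Gamma_A<\infty$ a.s., and $F$ can be represented as a mixture of a normalized extended gamma process: $$F(t)=\int\frac{k(t,x)}{\bar k(x)}\,\frac{d\Gamma_A^{1/\bar k}(x)}{\bar\Gamma_A^{1/\bar k}},\qquad \bar\Gamma_A^{1/\bar k}:=\lim_{x\to+\infty}\Gamma_A^{1/\bar k}(x)\in(0,\infty)\ \text{a.s.}$$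 (the integrand being $0$ where $\bar k(x)=0$). If, moreover, $\bar k(x)=b^{-1}$ for all $x$, with a constant $b>0$, then $F$ is an MDP: it can be represented as $F(t)=\int b\,k(t,x)\,d\mathcal D_A(x)$. (iii) Let $L=\Gamma_A$ and $k$ be as in (ii), let $k(\cdot,x)$ be absolutely continuous on bounded intervals for every $x$, and put $k'(t,x)=\partial k(t,x)/\partial t$. Let $g:\mathbb R\to\mathbb R$ be measurable with $\int|g(t)|\,dF(t)<\infty$ a.s., and let $h(x)=\int g(t)k'(t,x)\,dt$ (set equal to $0$ where this integral does not converge absolutely) and $\bar h(x)=\bar k(x)^{-1}h(x)$ (set equal to $0$ where $\bar k(x)=0$). Then the mean of $F$ can be represented as a mean of a normalized extended gamma process: $$\int g(t)\,dF(t)=\int\bar h(x)\,\frac{d\Gamma_A^{1/\bar k}(x)}{\bar\Gamma_A^{1/\bar k}},$$ where, on the space of $F$, the right-hand integral a.s. converges absolutely and $\bar\Gamma_A^{1/\bar k}\in(0,\infty)$ a.s. If, moreover, $\bar k(x)=b^{-1}$ for all $x$, with a constant $b>0$, then the mean can be represented as a mean of a Dirichlet process, $\int g(t)\,dF(t)=\int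 b\,h(x)\,d\mathcal D_A(x)$, again with a.s. absolute convergence on the space of $F$. -/

import Mathlib

open MeasureTheory ProbabilityTheory Filter Set Topology
open scoped NNReal ENNReal

universe u v

/-- The Lebesgue-Stieltjes measure `df` of a nondecreasing (right-continuous) function `f` on `ℝ`,
so that `∫ φ ∂(stieltjes f)` is `∫ φ df`. -/
noncomputable def stieltjes (f : ℝ → ℝ) : Measure ℝ :=
  open scoped Classical in if h : Monotone f then h.stieltjesFunction.measure else 0

section Processes

variable {Ω : Type*} [MeasurableSpace Ω]

/-- `L = {L(x) : x ∈ ℝ}` is an increasing additive process with Poisson intensity measure `ν`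
on `ℝ × (0, ∞)`: a process with independent increments, whose paths are almost surely finite,
nondecreasing, right-continuous and vanishing at `-∞`, and such that, for `r ≥ 0`,
`E exp(-r L(x)) = exp(- ∫_{(-∞, x] × (0, ∞)} (1 - exp(-r v)) ν(ds dv))`, with a finite exponent. -/
structure IsIAP (ν : Measure (ℝ × ℝ)) (L : ℝ → Ω → ℝ) (P : Measure Ω) : Prop where
  measurable : ∀ x, Measurable (L x)
  paths : ∀ᵐ ω ∂P, Monotone (fun x => L x ω) ∧
    (∀ x, ContinuousWithinAt (fun y => L y ω) (Ici x) x) ∧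
    Tendsto (fun x => L x ω) atBot (𝓝 0)
  indep : HasIndepIncrements L P
  exponent_ne_top : ∀ x r : ℝ, 0 ≤ r →
    ∫⁻ p in Iic x ×ˢ Ioi (0 : ℝ), ENNReal.ofReal (1 - Real.exp (-(r * p.2))) ∂ν ≠ ⊤
  laplace : ∀ x r : ℝ, 0 ≤ r →
    ∫ ω, Real.exp (-(r * L x ω)) ∂P =
      Real.exp (-(∫⁻ p in Iic x ×ˢ Ioi (0 : ℝ),
        ENNReal.ofReal (1 - Real.exp (-(r * p.2))) ∂ν).toReal)

/-- The measure `exp(-β(x) v) v⁻¹ dv dα(x)` on `ℝ × (0, ∞)`. The value `β(x) = ∞` is admitted,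
with `exp(-∞) = 0` (no jumps at `x`), only so that `β = 1 / c` makes sense where `c = 0`. -/
noncomputable def extGammaIntensity (α : Measure ℝ) (β : ℝ → ℝ≥0∞) : Measure (ℝ × ℝ) :=
  (α.prod (volume.restrict (Ioi (0 : ℝ)))).withDensity fun p =>
    if β p.1 = ⊤ then 0 else ENNReal.ofReal (Real.exp (-((β p.1).toReal * p.2)) * p.2⁻¹)

/-- The measure `exp(-v) v⁻¹ dv dα(x)` on `ℝ × (0, ∞)`. -/
noncomputable def gammaIntensity (α : Measure ℝ) : Measure (ℝ × ℝ) :=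
  (α.prod (volume.restrict (Ioi (0 : ℝ)))).withDensity fun p =>
    ENNReal.ofReal (Real.exp (-p.2) * p.2⁻¹)

/-- `L` is an extended gamma process `Γ_A^β`, with `A` the distribution function of `α`. -/
def IsExtGammaProcess (α : Measure ℝ) (β : ℝ → ℝ≥0∞) (L : ℝ → Ω → ℝ) (P : Measure Ω) : Prop :=
  IsIAP (extGammaIntensity α β) L P

/-- `L` is a (reparameterized) gamma process `Γ_A`, with `A` the distribution function of `α`. -/
def IsGammaProcess (α : Measure ℝ) (L : ℝ → Ω → ℝ) (P : Measure Ω) : Prop :=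
  IsIAP (gammaIntensity α) L P

/-- The limit of the path `L(·, ω)` at `+∞`. -/
noncomputable def totalMass (L : ℝ → Ω → ℝ) (ω : Ω) : ℝ :=
  limUnder atTop (fun x => L x ω)

/-- The normalized process `x ↦ L(x) / L(+∞)`. -/
noncomputable def normalizedProcess (L : ℝ → Ω → ℝ) (x : ℝ) (ω : Ω) : ℝ :=
  L x ω / totalMass L ω

end Processes

/-- `k̄(x) = lim_{t → +∞} k(t, x)`. -/
noncomputable def kbar (k : ℝ → ℝ → ℝ≥0) (x : ℝ) : ℝ≥0 :=
  limUnder atTop (fun t => k t x)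

/-- The conditions on the kernel `k` and the intensity `ν` under which `∫ k(t, x) dL(x)`,
`t ∈ ℝ`, can be normalized to a random probability distribution function. The last condition says
that `k̄` is positive on a set of infinite intensity; when `k̄ > 0` everywhere this is
`ν (ℝ × (0, ∞)) = ∞`. -/
structure KernelConditions (k : ℝ → ℝ → ℝ≥0) (ν : Measure (ℝ × ℝ)) : Prop where
  measurable : ∀ t, Measurable (k t)
  mono : ∀ x, Monotone (fun t => k t x)
  rightCont : ∀ x t, ContinuousWithinAt (fun s => k s x) (Ici t) t
  atBot : ∀ x, Tendsto (fun t => k t x) atBot (𝓝 0)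
  atTop : ∀ x, ∃ c, Tendsto (fun t => k t x) atTop (𝓝 c)
  finite : ∀ r : ℝ, 0 < r →
    ∫⁻ p in univ ×ˢ Ioi (0 : ℝ),
      ENNReal.ofReal (1 - Real.exp (-(r * p.2 * (kbar k p.1 : ℝ)))) ∂ν < ⊤
  infinite : ν {p | 0 < p.2 ∧ 0 < kbar k p.1} = ⊤

section Driven

variable {Ω : Type*} [MeasurableSpace Ω]

/-- `Z̄ = ∫ k̄(x) dL(x)`. -/
noncomputable def drivenTotal (k : ℝ → ℝ → ℝ≥0) (L : ℝ → Ω → ℝ) (ω : Ω) : ℝ≥0∞ :=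
  ∫⁻ x, (kbar k x : ℝ≥0∞) ∂(stieltjes fun y => L y ω)

/-- The normalized random distribution function driven by `L` with kernel `k`:
`F(t) = ∫ k(t, x) dL(x) / ∫ k̄(x) dL(x)`. -/
noncomputable def normalizedDF (k : ℝ → ℝ → ℝ≥0) (L : ℝ → Ω → ℝ) (t : ℝ) (ω : Ω) : ℝ :=
  ((∫⁻ x, (k t x : ℝ≥0∞) ∂(stieltjes fun y => L y ω)) / drivenTotal k L ω).toReal

/-- `f` is a probability distribution function on `ℝ`. -/
def IsProbDF (f : ℝ → ℝ) : Prop :=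
  Monotone f ∧ (∀ x, ContinuousWithinAt f (Ici x) x) ∧
    Tendsto f atBot (𝓝 0) ∧ Tendsto f atTop (𝓝 1)

/-- The Dirichlet distribution with parameters `a i ≥ 0`, not all zero: the law of the vector
`z i / ∑ j, z j`, where the `z i` are independent, `z i` being gamma distributed with shape `a i`
and rate `1` (and `z i = 0` if `a i = 0`). -/
noncomputable def dirichletLaw {n : ℕ} (a : Fin n → ℝ) : Measure (Fin n → ℝ) :=
  (Measure.pi fun i => if a i = 0 then Measure.dirac 0 else gammaMeasure (a i) 1).map
    fun z i => z i / ∑ j, z j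

/-- `D` is a Dirichlet random distribution function with parameter measure `α`: its paths are
almost surely probability distribution functions, and the random probabilities of the cells of any
finite measurable partition of `ℝ` have the Dirichlet distribution whose parameters are the
`α`-measures of the cells. -/
structure IsDirichletDF (α : Measure ℝ) (D : ℝ → Ω → ℝ) (P : Measure Ω) : Prop where
  measurable : ∀ x, Measurable (D x)
  paths : ∀ᵐ ω ∂P, IsProbDF (fun x => D x ω)
  law : ∀ (n : ℕ) (B : Fin n → Set ℝ), (∀ i, MeasurableSet (B i)) →
    Pairwise (fun i j => Disjoint (B i) (B j)) → (⋃ i, B i) = univ →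
    P.map (fun ω i => (stieltjes fun y => D y ω).real (B i)) = dirichletLaw fun i => α.real (B i)

/-- `F` is the mixture of the Dirichlet process `D` with mixing kernel `K`: every `K(·, x)` is a
probability distribution function and, almost surely, `F(t) = ∫ K(t, x) dD(x)` for all `t`. -/
structure IsMDP (α : Measure ℝ) (K : ℝ → ℝ → ℝ) (D : ℝ → Ω → ℝ) (F : ℝ → Ω → ℝ)
    (P : Measure Ω) : Prop where
  measurable_kernel : ∀ t, Measurable (K t)
  kernel : ∀ x, IsProbDF (fun t => K t x)
  dirichlet : IsDirichletDF α D P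
  eq : ∀ᵐ ω ∂P, ∀ t, F t ω = ∫ x, K t x ∂(stieltjes fun y => D y ω)

end Driven

/-- `h(x) = ∫ g(t) k'(t, x) dt`, with `k'(t, x) = ∂k(t, x)/∂t`. -/
noncomputable def meanKernel (k : ℝ → ℝ → ℝ≥0) (g : ℝ → ℝ) (x : ℝ) : ℝ :=
  ∫ t, g t * deriv (fun s => (k s x : ℝ)) t

/-!
A nondecreasing right-continuous path `L(·, ω)` vanishing at `-∞` is the same thing as its
Lebesgue-Stieltjes measure `stieltjes (L(·, ω))`, so an increasing additive process with intensity
`ν` is studied through the random measure `M = dL`. All the representations come from one formula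
for its Laplace functional,
`E exp (-∫ f dM) = exp (-∫ (1 - exp (-f(x) v)) ν(dx dv))`  for measurable `f : ℝ → [0, ∞)`.

* The definition of the process gives the formula on increments, hence, by independence, for
  step functions; continuous functions are limits of step functions, and an `L¹`-density argument
  with respect to a finite measure dominating all the measures involved gives all measurable
  functions (`IsIAP.hasLaplaceAt`).
* The Laplace functional determines the law of the random measure (`map_eq_of_laplace`): by the
  Stone-Weierstrass theorem, the law of a random vector with values in `[0, ∞]ⁿ` is determined by
  its Laplace transform, and the joint laws of finitely many values `M(B₁), …, M(Bₙ)` determine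
  the law of `M`.
* The formula makes it plain what multiplication of `M` by a density `w` does: it replaces
  `f` by `w f`. For gamma intensities, integrating `v` out turns the exponent into
  `∫ gammaExponent (β(x)) (f(x)) α(dx)`, where `gammaExponent b s = log (1 + s / b)` depends only on
  `s / b`. Hence `β dΓ_A^β` is a gamma measure, and `k̄ dΓ_A` is an extended gamma measure with rate
  `1 / k̄`. A random measure with such a Laplace functional is finite, and its distribution function
  is again an increasing additive process (`IsCompletelyRandom.exists_isIAP`); this gives the
  processes that have to be found on the space of `F`.
* A gamma measure has independent gamma distributed masses on disjoint sets, so its normalization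
  is a Dirichlet process; when `k̄` is the constant `1 / b`, normalizing `k̄ dΓ_A` or `dΓ_A` is the
  same.

The identities for all `t` simultaneously are then changes of density, path by path. Equality of
laws holds because both sides are the same measurable functional of random measures with the same
law. For the means, a normalized driven distribution function is the mixture of the probability
measures `dk(·, x) / k̄(x)` over a random probability measure (`stieltjes_mixture`); integrating `g`
against a mixture is an iterated integral, and for absolutely continuous `k(·, x)` the inner one
is `h(x) / k̄(x)`, because then `dk(·, x) = k'(t, x) dt`.
-/

/-! ### The Laplace transform on `[0, ∞]` -/

/-- The function `a ↦ exp (-a)` on `[0, ∞]`, with `exp (-∞) = 0`. -/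
noncomputable def expNeg (a : ℝ≥0∞) : ℝ := if a = ⊤ then 0 else Real.exp (-a.toReal)

@[simp] lemma expNeg_top : expNeg ⊤ = 0 := by simp [expNeg]

@[simp] lemma expNeg_zero : expNeg 0 = 1 := by simp [expNeg]

lemma expNeg_of_ne_top {a : ℝ≥0∞} (h : a ≠ ⊤) : expNeg a = Real.exp (-a.toReal) := by
  simp [expNeg, h]

lemma expNeg_ofReal {a : ℝ} (h : 0 ≤ a) : expNeg (ENNReal.ofReal a) = Real.exp (-a) := by
  rw [expNeg_of_ne_top ENNReal.ofReal_ne_top, ENNReal.toReal_ofReal h]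

lemma expNeg_coe (a : ℝ≥0) : expNeg a = Real.exp (-(a : ℝ)) := by
  rw [expNeg_of_ne_top ENNReal.coe_ne_top, ENNReal.coe_toReal]

lemma expNeg_nonneg (a : ℝ≥0∞) : 0 ≤ expNeg a := by
  unfold expNeg; split_ifs <;> positivity

lemma expNeg_le_one (a : ℝ≥0∞) : expNeg a ≤ 1 := by
  unfold expNeg; split_ifs
  · norm_num
  · simp

lemma expNeg_add (a b : ℝ≥0∞) : expNeg (a + b) = expNeg a * expNeg b := by
  by_cases ha : a = ⊤
  · simp [ha]
  by_cases hb : b = ⊤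
  · simp [hb]
  rw [expNeg_of_ne_top ha, expNeg_of_ne_top hb, expNeg_of_ne_top (by finiteness),
    ENNReal.toReal_add ha hb, neg_add, Real.exp_add]

lemma expNeg_sum {ι : Type*} (s : Finset ι) (a : ι → ℝ≥0∞) :
    expNeg (∑ i ∈ s, a i) = ∏ i ∈ s, expNeg (a i) := by
  classical
  induction s using Finset.induction_on with
  | empty => simp
  | insert i s hi ih => rw [Finset.sum_insert hi, Finset.prod_insert hi, expNeg_add, ih]

lemma expNeg_strictAnti : StrictAnti expNeg := by
  intro a b hab
  rw [expNeg_of_ne_top hab.ne_top]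
  by_cases hb : b = ⊤
  · simp [hb, Real.exp_pos]
  · rw [expNeg_of_ne_top hb]
    simpa using (ENNReal.toReal_lt_toReal hab.ne_top hb).2 hab

lemma expNeg_eq_toReal_exp (a : ℝ≥0∞) : expNeg a = (EReal.exp (-(a : EReal))).toReal := by
  induction a with
  | top => simp
  | coe a =>
    rw [expNeg_coe, show (((a : ℝ≥0∞) : EReal)) = ((a : ℝ) : EReal) from rfl, ← EReal.coe_neg,
      EReal.exp_coe, ENNReal.toReal_ofReal (Real.exp_nonneg _)]

lemma continuous_expNeg : Continuous expNeg := by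
  have : expNeg = fun a : ℝ≥0∞ => (EReal.exp (-(a : EReal))).toReal :=
    funext expNeg_eq_toReal_exp
  rw [this]
  refine ENNReal.continuousOn_toReal.comp_continuous
    (ENNReal.continuous_exp.comp (continuous_neg.comp continuous_coe_ennreal_ereal)) fun a => ?_
  have : EReal.exp (-(a : EReal)) ≤ 1 := by
    rw [EReal.exp_le_one_iff, EReal.neg_le_zero]
    exact EReal.coe_ennreal_nonneg a
  exact (this.trans_lt ENNReal.one_lt_top).ne

lemma measurable_expNeg : Measurable expNeg := continuous_expNeg.measurable

lemma expNeg_eq_one_iff {a : ℝ≥0∞} : expNeg a = 1 ↔ a = 0 := by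
  rw [← expNeg_zero, expNeg_strictAnti.injective.eq_iff]

lemma expNeg_eq_zero_iff {a : ℝ≥0∞} : expNeg a = 0 ↔ a = ⊤ := by
  rw [← expNeg_top, expNeg_strictAnti.injective.eq_iff]

lemma integrable_expNeg {Ω : Type*} [MeasurableSpace Ω] {P : Measure Ω} [IsFiniteMeasure P]
    {Y : Ω → ℝ≥0∞} (hY : AEMeasurable Y P) : Integrable (fun ω => expNeg (Y ω)) P := by
  refine Integrable.of_bound (measurable_expNeg.comp_aemeasurable hY).aestronglyMeasurable 1 ?_
  refine ae_of_all _ fun ω => ?_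
  rw [Real.norm_of_nonneg (expNeg_nonneg _)]
  exact expNeg_le_one _

/-- If `Y n → Y` almost surely in `[0, ∞]`, then the Laplace transforms converge. -/
lemma tendsto_integral_expNeg {Ω : Type*} [MeasurableSpace Ω] {P : Measure Ω} [IsFiniteMeasure P]
    {Y : ℕ → Ω → ℝ≥0∞} {Z : Ω → ℝ≥0∞} (hY : ∀ n, AEMeasurable (Y n) P)
    (h : ∀ᵐ ω ∂P, Tendsto (fun n => Y n ω) atTop (𝓝 (Z ω))) :
    Tendsto (fun n => ∫ ω, expNeg (Y n ω) ∂P) atTop (𝓝 (∫ ω, expNeg (Z ω) ∂P)) := by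
  refine tendsto_integral_of_dominated_convergence (fun _ => 1)
    (fun n => (integrable_expNeg (hY n)).1) (integrable_const _) (fun n => ae_of_all _ fun ω => ?_)
    (h.mono fun ω hω => (continuous_expNeg.tendsto _).comp hω)
  rw [Real.norm_of_nonneg (expNeg_nonneg _)]
  exact expNeg_le_one _

/-- The bounded continuous function `a ↦ exp (-∑ i, r i * a i)` on `[0, ∞]^ι`. -/
noncomputable def laplaceBCF {ι : Type*} [Fintype ι] (r : ι → ℝ≥0) :
    BoundedContinuousFunction (ι → ℝ≥0∞) ℝ :=
  BoundedContinuousFunction.ofNormedAddCommGroup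
    (fun a => expNeg (∑ i, (r i : ℝ≥0∞) * a i))
    (continuous_expNeg.comp (continuous_finsetSum _ fun i _ =>
      (ENNReal.continuous_const_mul ENNReal.coe_ne_top).comp (continuous_apply i))) 1
    (fun a => by rw [Real.norm_of_nonneg (expNeg_nonneg _)]; exact expNeg_le_one _)

lemma laplaceBCF_apply {ι : Type*} [Fintype ι] (r : ι → ℝ≥0) (a : ι → ℝ≥0∞) :
    laplaceBCF r a = expNeg (∑ i, (r i : ℝ≥0∞) * a i) := rfl

lemma laplaceBCF_mul {ι : Type*} [Fintype ι] (r s : ι → ℝ≥0) :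
    laplaceBCF r * laplaceBCF s = laplaceBCF (r + s) := by
  ext a
  simp [laplaceBCF_apply, ← expNeg_add, ← Finset.sum_add_distrib, add_mul]

/-- The algebra of functions on `[0, ∞]^ι` spanned by the exponentials
`a ↦ exp (-∑ i, r i * a i)`. -/
noncomputable def laplaceAlgebra (ι : Type*) [Fintype ι] :
    StarSubalgebra ℝ (BoundedContinuousFunction (ι → ℝ≥0∞) ℝ) where
  toSubalgebra := (Submodule.span ℝ (range laplaceBCF)).toSubalgebra
    (Submodule.subset_span ⟨0, by ext a; simp [laplaceBCF_apply]⟩)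
    (fun f g hf hg => by
      have h := Submodule.mul_mem_mul hf hg
      rw [Submodule.span_mul_span] at h
      refine Submodule.span_mono ?_ h
      rintro _ ⟨_, ⟨r, rfl⟩, _, ⟨s, rfl⟩, rfl⟩
      exact ⟨r + s, (laplaceBCF_mul r s).symm⟩)
  star_mem' := fun {f} hf => by
    have : star f = f := by ext a; simp
    rwa [this]

/-- A finite measure on `[0, ∞]^ι` is determined by its Laplace transform, because the exponentials
span an algebra that separates the points of `[0, ∞]^ι`. -/
lemma ext_of_laplace {ι : Type*} [Fintype ι] {Q Q' : Measure (ι → ℝ≥0∞)} [IsFiniteMeasure Q]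
    [IsFiniteMeasure Q']
    (h : ∀ r : ι → ℝ≥0, ∫ a, expNeg (∑ i, (r i : ℝ≥0∞) * a i) ∂Q =
      ∫ a, expNeg (∑ i, (r i : ℝ≥0∞) * a i) ∂Q') : Q = Q' := by
  classical
  refine ext_of_forall_mem_subalgebra_integral_eq_of_polish (𝕜 := ℝ) (A := laplaceAlgebra ι) ?_ ?_
  · intro a b hab
    obtain ⟨i, hi⟩ : ∃ i, a i ≠ b i := by
      by_contra hc
      push Not at hc
      exact hab (funext hc)
    refine ⟨laplaceBCF (Pi.single i 1), ⟨_, ⟨laplaceBCF (Pi.single i 1),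
      Submodule.subset_span ⟨_, rfl⟩, rfl⟩, rfl⟩, ?_⟩
    have key : ∀ c : ι → ℝ≥0∞,
        ∑ j, ((Pi.single i (1 : ℝ≥0) : ι → ℝ≥0) j : ℝ≥0∞) * c j = c i := by
      intro c
      rw [Finset.sum_eq_single i]
      · simp
      · intro j _ hj
        simp [Pi.single_eq_of_ne hj]
      · simp
    rw [laplaceBCF_apply, laplaceBCF_apply, key, key]
    exact fun h => hi (expNeg_strictAnti.injective h)
  · intro g hg
    change g ∈ Submodule.span ℝ (range laplaceBCF) at hg
    induction hg using Submodule.span_induction with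
    | mem x hx =>
      obtain ⟨r, rfl⟩ := hx
      exact h r
    | zero => simp
    | add x y _ _ hx hy =>
      simp only [BoundedContinuousFunction.coe_add, Pi.add_apply]
      rw [integral_add (x.integrable _) (y.integrable _),
        integral_add (x.integrable _) (y.integrable _), hx, hy]
    | smul c x _ hx =>
      simp only [BoundedContinuousFunction.coe_smul, smul_eq_mul]
      rw [integral_const_mul, integral_const_mul, hx]

/-! ### Laws of random measures -/

/-- The family of all values `m B`, `B` measurable. -/
def measureValues (m : Measure ℝ) (B : {B : Set ℝ // MeasurableSet B}) : ℝ≥0∞ := m B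

lemma measurable_measureValues : Measurable measureValues :=
  measurable_pi_lambda _ fun B => Measure.measurable_coe B.2

lemma exists_preimage_measureValues {S : Set (Measure ℝ)} (hS : MeasurableSet S) :
    ∃ T, MeasurableSet T ∧ measureValues ⁻¹' T = S := by
  have h : (Measure.instMeasurableSpace : MeasurableSpace (Measure ℝ)) ≤
      MeasurableSpace.comap measureValues inferInstance := by
    refine iSup₂_le fun B hB => ?_
    rintro _ ⟨T, hT, rfl⟩
    exact ⟨(fun a => a ⟨B, hB⟩) ⁻¹' T, measurable_pi_apply _ hT, rfl⟩
  exact h _ hS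

/-- The law of a random measure is determined by the Laplace functional on simple functions: these
give the joint laws of finitely many values of the measure. -/
theorem map_eq_of_laplace {Ω : Type u} {Ω' : Type v} [MeasurableSpace Ω] [MeasurableSpace Ω']
    {P : Measure Ω} {P' : Measure Ω'} [IsFiniteMeasure P] [IsFiniteMeasure P']
    {M : Ω → Measure ℝ} {M' : Ω' → Measure ℝ} (hM : AEMeasurable M P) (hM' : AEMeasurable M' P')
    (h : ∀ f : ℝ → ℝ≥0, Measurable f → (range f).Finite →
      ∫ ω, expNeg (∫⁻ x, f x ∂M ω) ∂P = ∫ ω, expNeg (∫⁻ x, f x ∂M' ω) ∂P') :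
    P.map M = P'.map M' := by
  classical
  have h1 : (P.map M).map measureValues = (P'.map M').map measureValues := by
    refine IsProjectiveLimit.unique
      (P := fun I => ((P.map M).map measureValues).map I.restrict) (fun I => rfl) fun I => ?_
    have hmeas : Measurable (fun m : Measure ℝ => I.restrict (measureValues m)) :=
      (Finset.measurable_restrict _).comp measurable_measureValues
    beta_reduce
    rw [Measure.map_map (Finset.measurable_restrict _) measurable_measureValues,
      Measure.map_map (Finset.measurable_restrict _) measurable_measureValues]
    have e : I.restrict ∘ measureValues = fun m : Measure ℝ => I.restrict (measureValues m) := rfl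
    rw [e]
    refine ext_of_laplace fun r => ?_
    have hc : Measurable fun a : I → ℝ≥0∞ => expNeg (∑ i, (r i : ℝ≥0∞) * a i) :=
      measurable_expNeg.comp (by fun_prop)
    have hcm : Measurable fun m : Measure ℝ =>
        expNeg (∑ i, (r i : ℝ≥0∞) * I.restrict (measureValues m) i) := hc.comp hmeas
    rw [integral_map hmeas.aemeasurable hc.aestronglyMeasurable,
      integral_map hmeas.aemeasurable hc.aestronglyMeasurable,
      integral_map hM' hcm.aestronglyMeasurable, integral_map hM hcm.aestronglyMeasurable]
    let f : ℝ → ℝ≥0 := fun x => ∑ i : I, (i.1 : Set ℝ).indicator (fun _ => r i) x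
    have hfm : Measurable f :=
      Finset.measurable_fun_sum _ fun i _ => measurable_const.indicator i.1.2
    have hfr : (range f).Finite := by
      refine (finite_range fun s : Set I => ∑ i : I, s.indicator r i).subset ?_
      rintro _ ⟨x, rfl⟩
      let s : Set I := {i | x ∈ (i.1 : Set ℝ)}
      refine ⟨s, Finset.sum_congr rfl fun i _ => ?_⟩
      by_cases hx : x ∈ (i.1 : Set ℝ)
      · rw [indicator_of_mem hx, indicator_of_mem (show i ∈ s from hx)]
      · rw [indicator_of_notMem hx, indicator_of_notMem (show i ∉ s from hx)]
    have hf : ∀ m : Measure ℝ, ∑ i, (r i : ℝ≥0∞) * I.restrict (measureValues m) i =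
        ∫⁻ x, f x ∂m := by
      intro m
      have : ∀ x, (f x : ℝ≥0∞) = ∑ i : I, (i.1 : Set ℝ).indicator (fun _ => (r i : ℝ≥0∞)) x := by
        intro x
        rw [ENNReal.ofNNReal_finsetSum]
        refine Finset.sum_congr rfl fun i _ => ?_
        by_cases hx : x ∈ (i.1 : Set ℝ) <;> simp [hx]
      simp_rw [this]
      rw [lintegral_finsetSum _ fun i _ => measurable_const.indicator i.1.2]
      refine Finset.sum_congr rfl fun i _ => ?_
      rw [lintegral_indicator_const i.1.2]
      rfl
    simp_rw [hf]
    exact (h f hfm hfr).symm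
  ext S hS
  obtain ⟨T, hT, rfl⟩ := exists_preimage_measureValues hS
  rw [← Measure.map_apply measurable_measureValues hT, h1,
    Measure.map_apply measurable_measureValues hT]

/-! ### Paths and their Lebesgue-Stieltjes measures -/

/-- A nondecreasing right-continuous function vanishing at `-∞`. -/
def IsIncreasingPath (f : ℝ → ℝ) : Prop :=
  Monotone f ∧ (∀ x, ContinuousWithinAt f (Ici x) x) ∧ Tendsto f atBot (𝓝 0)

lemma IsIncreasingPath.nonneg {f : ℝ → ℝ} (hf : IsIncreasingPath f) (x : ℝ) : 0 ≤ f x :=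
  hf.1.le_of_tendsto hf.2.2 x

lemma isIncreasingPath_zero : IsIncreasingPath fun _ => 0 :=
  ⟨monotone_const, fun _ => continuousWithinAt_const, tendsto_const_nhds⟩

lemma stieltjes_Iic {f : ℝ → ℝ} (hf : IsIncreasingPath f) (x : ℝ) :
    stieltjes f (Iic x) = ENNReal.ofReal (f x) := by
  have h : ⇑hf.1.stieltjesFunction = f := by
    ext y
    rw [hf.1.stieltjesFunction_eq]
    exact rightLim_eq_of_tendsto ((hf.2.1 y).mono Ioi_subset_Ici_self)
  rw [stieltjes, dif_pos hf.1, StieltjesFunction.measure_Iic _ (by rw [h]; exact hf.2.2), h,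
    sub_zero]

lemma stieltjes_Ioc {f : ℝ → ℝ} (hf : IsIncreasingPath f) {a b : ℝ} (hab : a ≤ b) :
    stieltjes f (Ioc a b) = ENNReal.ofReal (f b - f a) := by
  rw [← Iic_sdiff_Iic, measure_sdiff (Iic_subset_Iic.2 hab) measurableSet_Iic.nullMeasurableSet
    (by rw [stieltjes_Iic hf]; exact ENNReal.ofReal_ne_top), stieltjes_Iic hf, stieltjes_Iic hf,
    ← ENNReal.ofReal_sub _ (hf.nonneg _)]

/-- A measure finite on every `(-∞, x]` is determined by these values. -/
lemma measure_ext_of_Iic {m m' : Measure ℝ} (h : ∀ x, m (Iic x) = m' (Iic x))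
    (hfin : ∀ x, m (Iic x) ≠ ⊤) : m = m' := by
  refine Measure.ext_of_generateFrom_of_iUnion (range Iic) (fun n : ℕ => Iic (n : ℝ))
    (borel_eq_generateFrom_Iic ℝ ▸ BorelSpace.measurable_eq) isPiSystem_Iic ?_
    (fun n => ⟨_, rfl⟩) (fun n => hfin _) ?_
  · exact iUnion_eq_univ_iff.2 fun x => exists_nat_ge x
  · rintro _ ⟨x, rfl⟩
    exact h x

lemma isIncreasingPath_measureReal (m : Measure ℝ) [IsFiniteMeasure m] :
    IsIncreasingPath fun x => m.real (Iic x) := by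
  refine ⟨fun x y hxy => measureReal_mono (Iic_subset_Iic.2 hxy), fun x => ?_, ?_⟩
  · have h : Tendsto (fun y => m (Iic y)) (𝓝[>] x) (𝓝 (m (Iic x))) := by
      have := tendsto_measure_biInter_gt (μ := m) (s := fun y : ℝ => Iic y) (a := x)
        (fun r _ => measurableSet_Iic.nullMeasurableSet)
        (fun i j _ hij => Iic_subset_Iic.2 hij) ⟨x + 1, by simp, measure_ne_top _ _⟩
      rwa [show (⋂ r > x, Iic r) = Iic x by
        ext z; simp only [mem_iInter, mem_Iic]
        exact ⟨fun h => le_of_forall_gt_imp_ge_of_dense h, fun h r hr => h.trans hr.le⟩] at this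
    rw [← continuousWithinAt_Ioi_iff_Ici]
    exact (ENNReal.tendsto_toReal (measure_ne_top _ _)).comp h
  · have := (ENNReal.tendsto_toReal (measure_ne_top m ∅)).comp
      (show Tendsto (fun x => m (Iic x)) atBot (𝓝 (m ∅)) by
        have := tendsto_measure_iInter_atBot (μ := m) (s := fun y : ℝ => Iic y)
          (fun i => measurableSet_Iic.nullMeasurableSet) (fun i j hij => Iic_subset_Iic.2 hij)
          ⟨0, measure_ne_top _ _⟩
        rwa [iInter_Iic_eq_empty_iff.2 (by simp [not_bddBelow_univ])] at this)
    simpa [Function.comp_def, Measure.real] using this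

/-- A path whose values are the masses `m (-∞, x]` has Lebesgue-Stieltjes measure `m`. -/
lemma stieltjes_eq_of_measureReal {m : Measure ℝ} [IsFiniteMeasure m] {f : ℝ → ℝ}
    (h : ∀ x, f x = m.real (Iic x)) : stieltjes f = m := by
  obtain rfl : f = fun x => m.real (Iic x) := funext h
  refine (measure_ext_of_Iic (fun x => ?_) fun x => measure_ne_top _ _).symm
  rw [stieltjes_Iic (isIncreasingPath_measureReal m), ofReal_measureReal]

lemma stieltjes_Iic_toReal {f : ℝ → ℝ} (hf : IsIncreasingPath f) (x : ℝ) :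
    (stieltjes f (Iic x)).toReal = f x := by
  rw [stieltjes_Iic hf, ENNReal.toReal_ofReal (hf.nonneg x)]

lemma tendsto_of_stieltjes_univ {f : ℝ → ℝ} (hf : IsIncreasingPath f)
    (h : stieltjes f univ ≠ ⊤) : Tendsto f atTop (𝓝 (stieltjes f univ).toReal) := by
  have := (ENNReal.tendsto_toReal h).comp
    (show Tendsto (fun x => stieltjes f (Iic x)) atTop (𝓝 (stieltjes f univ)) by
      have := tendsto_measure_iUnion_atTop (μ := stieltjes f) (s := fun y : ℝ => Iic y)
        (fun i j hij => Iic_subset_Iic.2 hij)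
      rwa [iUnion_Iic] at this)
  simpa [Function.comp_def, stieltjes_Iic_toReal hf] using this

lemma stieltjes_univ_of_isProbDF {f : ℝ → ℝ} (hf : IsProbDF f) : stieltjes f univ = 1 := by
  have h : IsIncreasingPath f := ⟨hf.1, hf.2.1, hf.2.2.1⟩
  refine tendsto_nhds_unique (f := fun x : ℝ => stieltjes f (Iic x)) (l := atTop) ?_ ?_
  · have := tendsto_measure_iUnion_atTop (μ := stieltjes f) (s := fun y : ℝ => Iic y)
        (fun i j hij => Iic_subset_Iic.2 hij)
    rwa [iUnion_Iic] at this
  · simp_rw [stieltjes_Iic h]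
    simpa using ENNReal.tendsto_ofReal hf.2.2.2

section RandomPaths

variable {Ω : Type u} [MeasurableSpace Ω]

/-- The Lebesgue-Stieltjes measure of the paths of a process that almost surely has increasing
right-continuous paths is a random measure. -/
lemma aemeasurable_stieltjes {P : Measure Ω} {L : ℝ → Ω → ℝ} (hm : ∀ x, Measurable (L x))
    (hp : ∀ᵐ ω ∂P, IsIncreasingPath fun x => L x ω) :
    AEMeasurable (fun ω => stieltjes fun y => L y ω) P := by
  classical
  obtain ⟨N, hN, hNm, hN0⟩ := exists_measurable_superset_of_null (ae_iff.1 hp)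
  let L' : ℝ → Ω → ℝ := fun x ω => if ω ∈ N then 0 else L x ω
  have hL' : ∀ ω, IsIncreasingPath fun x => L' x ω := by
    intro ω
    by_cases h : ω ∈ N
    · simpa [L', h] using isIncreasingPath_zero
    · have : IsIncreasingPath fun x => L x ω := by
        by_contra hc
        exact h (hN hc)
      simpa [L', h] using this
  have hL'm : ∀ x, Measurable (L' x) := fun x => Measurable.ite hNm measurable_const (hm x)
  refine ⟨fun ω => stieltjes fun y => L' y ω, ?_, ?_⟩
  · have hr : ∀ n : ℕ, Measurable fun ω => (stieltjes fun y => L' y ω).restrict (Iic (n : ℝ)) := by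
      intro n
      have : ∀ ω, IsFiniteMeasure ((stieltjes fun y => L' y ω).restrict (Iic (n : ℝ))) := by
        intro ω
        refine ⟨?_⟩
        rw [Measure.restrict_apply_univ, stieltjes_Iic (hL' ω)]
        exact ENNReal.ofReal_lt_top
      refine Measurable.measure_of_isPiSystem (S := range Iic)
        (borel_eq_generateFrom_Iic ℝ ▸ BorelSpace.measurable_eq) isPiSystem_Iic ?_ ?_
      · rintro _ ⟨x, rfl⟩
        simp_rw [Measure.restrict_apply measurableSet_Iic, Iic_inter_Iic, stieltjes_Iic (hL' _)]
        exact (hL'm _).ennreal_ofReal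
      · simp_rw [Measure.restrict_apply_univ, stieltjes_Iic (hL' _)]
        exact (hL'm _).ennreal_ofReal
    refine Measure.measurable_of_measurable_coe _ fun B hB => ?_
    have : (fun ω => (stieltjes fun y => L' y ω) B) =
        fun ω => ⨆ n : ℕ, (stieltjes fun y => L' y ω).restrict (Iic (n : ℝ)) B := by
      ext ω
      simp_rw [Measure.restrict_apply hB]
      rw [← Monotone.measure_iUnion]
      · congr 1
        have hu : ⋃ n : ℕ, Iic (n : ℝ) = univ := iUnion_eq_univ_iff.2 fun x => exists_nat_ge x
        rw [← inter_iUnion, hu, inter_univ]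
      · intro i j hij
        exact inter_subset_inter_right _ (Iic_subset_Iic.2 (by exact_mod_cast hij))
    rw [this]
    exact Measurable.iSup fun n => Measure.measurable_coe hB |>.comp (hr n)
  · have : ∀ᵐ ω ∂P, ω ∉ N := measure_eq_zero_iff_ae_notMem.1 hN0
    filter_upwards [this] with ω hω
    simp [L', hω]

end RandomPaths

/-- The Bochner integral of a fixed measurable function is a measurable function of the measure. -/
lemma measurable_integral_measure {φ : ℝ → ℝ} (hφ : Measurable φ) :
    Measurable fun m : Measure ℝ => ∫ x, φ x ∂m := by
  classical
  have : (fun m : Measure ℝ => ∫ x, φ x ∂m) = fun m : Measure ℝ =>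
      if ∫⁻ x, ‖φ x‖ₑ ∂m < ⊤ then (∫⁻ x, ENNReal.ofReal (φ x) ∂m).toReal -
        (∫⁻ x, ENNReal.ofReal (-φ x) ∂m).toReal else 0 := by
    ext m
    split_ifs with h
    · exact integral_eq_lintegral_pos_part_sub_lintegral_neg_part ⟨hφ.aestronglyMeasurable, h⟩
    · exact integral_undef fun hi => h hi.2
  rw [this]
  refine Measurable.ite (measurableSet_lt (Measure.measurable_lintegral hφ.enorm) measurable_const)
    (Measurable.sub ?_ ?_) measurable_const
  · exact (Measure.measurable_lintegral hφ.ennreal_ofReal).ennreal_toReal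
  · exact (Measure.measurable_lintegral hφ.neg.ennreal_ofReal).ennreal_toReal

/-! ### Normalization -/

section Normalization

variable {Ω : Type u}

lemma totalMass_eq {G : ℝ → Ω → ℝ} {ω : Ω} (hf : IsIncreasingPath fun x => G x ω)
    (h : stieltjes (fun y => G y ω) univ ≠ ⊤) :
    totalMass G ω = (stieltjes (fun y => G y ω) univ).toReal :=
  (tendsto_of_stieltjes_univ hf h).limUnder_eq

lemma stieltjes_normalizedProcess {G : ℝ → Ω → ℝ} {ω : Ω}
    (hf : IsIncreasingPath fun x => G x ω) (h : stieltjes (fun y => G y ω) univ ≠ ⊤)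
    (h0 : stieltjes (fun y => G y ω) univ ≠ 0) :
    stieltjes (fun y => normalizedProcess G y ω) =
      (stieltjes (fun y => G y ω) univ)⁻¹ • stieltjes (fun y => G y ω) := by
  have : IsFiniteMeasure (stieltjes fun y => G y ω) := ⟨h.lt_top⟩
  have : IsFiniteMeasure ((stieltjes (fun y => G y ω) univ)⁻¹ • stieltjes (fun y => G y ω)) :=
    Measure.smul_finite _ (ENNReal.inv_ne_top.2 h0)
  refine stieltjes_eq_of_measureReal fun x => ?_
  rw [measureReal_ennreal_smul_apply, Measure.real, stieltjes_Iic_toReal hf, normalizedProcess,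
    totalMass_eq hf h, ENNReal.toReal_inv, div_eq_inv_mul]

end Normalization

/-! ### Exponents of gamma intensities -/

/-- The Lévy exponent `∫ (1 - exp (-f(x) v)) ν(dx dv)` of a `[0, ∞]`-valued function `f`. -/
noncomputable def levyExponent (ν : Measure (ℝ × ℝ)) (f : ℝ → ℝ≥0∞) : ℝ≥0∞ :=
  ∫⁻ p in univ ×ˢ Ioi (0 : ℝ), ENNReal.ofReal (1 - expNeg (f p.1 * ENNReal.ofReal p.2)) ∂ν

/-- The integral `∫ (1 - exp (-s v)) exp (-b v) v⁻¹ dv` over `(0, ∞)`, which is `log (1 + s / b)`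
where this makes sense. It vanishes for `b = ∞`. -/
noncomputable def gammaExponent (b s : ℝ≥0∞) : ℝ≥0∞ :=
  ∫⁻ v in Ioi (0 : ℝ), (if b = ⊤ then 0 else ENNReal.ofReal (Real.exp (-(b.toReal * v)) * v⁻¹)) *
    ENNReal.ofReal (1 - expNeg (s * ENNReal.ofReal v))

lemma measurable_one_sub_expNeg {γ : Type*} [MeasurableSpace γ] {f : γ → ℝ≥0∞} {g : γ → ℝ}
    (hf : Measurable f) (hg : Measurable g) :
    Measurable fun p => ENNReal.ofReal (1 - expNeg (f p * ENNReal.ofReal (g p))) :=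
  ((measurable_expNeg.comp (hf.mul hg.ennreal_ofReal)).const_sub 1).ennreal_ofReal

lemma measurable_extGammaDensity {β : ℝ → ℝ≥0∞} (hβ : Measurable β) :
    Measurable fun p : ℝ × ℝ =>
      if β p.1 = ⊤ then 0 else ENNReal.ofReal (Real.exp (-((β p.1).toReal * p.2)) * p.2⁻¹) := by
  refine Measurable.ite ((hβ.comp measurable_fst) (measurableSet_singleton ⊤)) measurable_const ?_
  fun_prop

lemma gammaIntensity_eq (α : Measure ℝ) :
    gammaIntensity α = extGammaIntensity α fun _ => 1 := by
  simp [gammaIntensity, extGammaIntensity]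

lemma levyExponent_extGamma (α : Measure ℝ) [IsFiniteMeasure α] {β f : ℝ → ℝ≥0∞}
    (hβ : Measurable β) (hf : Measurable f) :
    levyExponent (extGammaIntensity α β) f = ∫⁻ x, gammaExponent (β x) (f x) ∂α := by
  have hm := measurable_extGammaDensity hβ
  have hm' : Measurable fun p : ℝ × ℝ => ENNReal.ofReal (1 - expNeg (f p.1 * ENNReal.ofReal p.2)) :=
    measurable_one_sub_expNeg (hf.comp measurable_fst) measurable_snd
  rw [levyExponent, extGammaIntensity,
    restrict_withDensity (MeasurableSet.univ.prod measurableSet_Ioi),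
    lintegral_withDensity_eq_lintegral_mul _ hm hm', ← Measure.prod_restrict,
    Measure.restrict_univ, Measure.restrict_restrict measurableSet_Ioi, inter_self,
    lintegral_prod _ (hm.mul hm').aemeasurable]
  rfl

lemma gammaExponent_top_left (s : ℝ≥0∞) : gammaExponent ⊤ s = 0 := by simp [gammaExponent]

lemma gammaExponent_zero_right (b : ℝ≥0∞) : gammaExponent b 0 = 0 := by simp [gammaExponent]

lemma gammaExponent_mono_right (b : ℝ≥0∞) : Monotone (gammaExponent b) := by
  intro s t hst
  unfold gammaExponent
  gcongr with v
  exact expNeg_strictAnti.antitone (by gcongr)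

lemma gammaExponent_anti_left {b c : ℝ≥0∞} (h : b ≤ c) (s : ℝ≥0∞) :
    gammaExponent c s ≤ gammaExponent b s := by
  by_cases hc : c = ⊤
  · simp [hc, gammaExponent_top_left]
  have hb : b ≠ ⊤ := ne_top_of_le_ne_top hc h
  unfold gammaExponent
  simp only [if_neg hc, if_neg hb]
  refine setLIntegral_mono' measurableSet_Ioi fun v (hv : 0 < v) => ?_
  gcongr

/-- The Frullani integral `∫ (1 - exp (-s v)) exp (-b v) v⁻¹ dv = log (1 + s / b)`. -/
lemma lintegral_frullani {b s : ℝ} (hb : 0 < b) (hs : 0 ≤ s) :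
    ∫⁻ v in Ioi (0 : ℝ), ENNReal.ofReal (Real.exp (-(b * v)) * v⁻¹) *
      ENNReal.ofReal (1 - Real.exp (-(s * v))) = ENNReal.ofReal (Real.log (1 + s / b)) := by
  have h1 : ∀ v ∈ Ioi (0 : ℝ), ENNReal.ofReal (Real.exp (-(b * v)) * v⁻¹) *
      ENNReal.ofReal (1 - Real.exp (-(s * v))) =
      ∫⁻ u in Ioc 0 s, ENNReal.ofReal (Real.exp (-((b + u) * v))) := by
    intro v hv
    have hv : 0 < v := hv
    have hd : ∀ u ∈ uIcc 0 s, HasDerivAt (fun u => -(Real.exp (-((b + u) * v)) * v⁻¹))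
        (Real.exp (-((b + u) * v))) u := by
      intro u _
      have h1 : HasDerivAt (fun u => -((b + u) * v)) (-(1 * v)) u :=
        (((hasDerivAt_id u).const_add b).mul_const v).neg
      have h2 : -(Real.exp (-((b + u) * v)) * -(1 * v) * v⁻¹) = Real.exp (-((b + u) * v)) := by
        field_simp
      exact h2 ▸ (h1.exp.mul_const v⁻¹).neg
    have hI := intervalIntegral.integral_eq_sub_of_hasDerivAt hd
      (Continuous.intervalIntegrable (by fun_prop) _ _)
    rw [← ofReal_integral_eq_lintegral_ofReal
      ((Continuous.integrableOn_Icc (by fun_prop)).mono_set Ioc_subset_Icc_self)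
      (ae_of_all _ fun u => (Real.exp_pos _).le), ← intervalIntegral.integral_of_le hs, hI,
      ← ENNReal.ofReal_mul (by positivity)]
    congr 1
    rw [add_mul, neg_add, Real.exp_add]
    simp
    ring
  rw [setLIntegral_congr_fun measurableSet_Ioi h1, lintegral_lintegral_swap (by
    apply Measurable.aemeasurable; fun_prop)]
  have h2 : ∀ u ∈ Ioc 0 s, ∫⁻ v in Ioi (0 : ℝ), ENNReal.ofReal (Real.exp (-((b + u) * v))) =
      ENNReal.ofReal (b + u)⁻¹ := by
    intro u hu
    have hbu : 0 < b + u := add_pos hb hu.1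
    have hi : IntegrableOn (fun v => Real.exp (-((b + u) * v))) (Ioi 0) := by
      exact (exp_neg_integrableOn_Ioi 0 hbu).congr_fun (fun v _ => by simp only [neg_mul])
        measurableSet_Ioi
    rw [← ofReal_integral_eq_lintegral_ofReal hi (ae_of_all _ fun u => (Real.exp_pos _).le)]
    congr 1
    have := integral_exp_mul_Ioi (a := -(b + u)) (by linarith) 0
    simp only [mul_zero, Real.exp_zero] at this
    simp_rw [← neg_mul, this]
    field_simp
  rw [setLIntegral_congr_fun measurableSet_Ioc h2]
  have hd : ∀ u ∈ uIcc 0 s, HasDerivAt (fun u => Real.log (b + u)) (b + u)⁻¹ u := by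
    intro u hu
    rw [uIcc_of_le hs] at hu
    have hbu : b + u ≠ 0 := by linarith [hu.1]
    simpa using ((hasDerivAt_id u).const_add b).log hbu
  have hc : ContinuousOn (fun u => (b + u)⁻¹) (Icc 0 s) :=
    ContinuousOn.inv₀ (by fun_prop) fun u hu => by linarith [hu.1]
  have hI := intervalIntegral.integral_eq_sub_of_hasDerivAt hd
    (ContinuousOn.intervalIntegrable (by rwa [uIcc_of_le hs]))
  rw [← ofReal_integral_eq_lintegral_ofReal
    (hc.integrableOn_Icc.mono_set Ioc_subset_Icc_self)
    ((ae_restrict_iff' measurableSet_Ioc).2 (ae_of_all _ fun u hu => by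
      have := hu.1
      simp only [Pi.zero_apply]; positivity)),
    ← intervalIntegral.integral_of_le hs, hI]
  congr 1
  rw [add_zero, ← Real.log_div (by positivity) hb.ne']
  congr 1
  field_simp

lemma gammaExponent_coe {b : ℝ≥0} (hb : b ≠ 0) (s : ℝ≥0) :
    gammaExponent b s = ENNReal.ofReal (Real.log (1 + s / b)) := by
  have hF := lintegral_frullani (b := b) (s := s) (by positivity) s.coe_nonneg
  rw [← hF, gammaExponent]
  refine setLIntegral_congr_fun measurableSet_Ioi fun v hv => ?_
  have hv : 0 < v := hv
  have : (s : ℝ≥0∞) * ENNReal.ofReal v = ENNReal.ofReal (s * v) := by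
    rw [ENNReal.ofReal_mul s.coe_nonneg, ENNReal.ofReal_coe_nnreal]
  simp only [ENNReal.coe_ne_top, if_false, ENNReal.coe_toReal]
  rw [this, expNeg_ofReal (by positivity)]

lemma gammaExponent_one (s : ℝ≥0) :
    gammaExponent 1 s = ENNReal.ofReal (Real.log (1 + s)) := by
  simpa using gammaExponent_coe one_ne_zero s

lemma gammaExponent_top_right {b : ℝ≥0∞} (hb : b ≠ ⊤) : gammaExponent b ⊤ = ⊤ := by
  have key : ∀ c : ℝ≥0, c ≠ 0 → gammaExponent c ⊤ = ⊤ := by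
    intro c hc
    refine ENNReal.eq_top_of_forall_nnreal_le fun r => ?_
    have h0 : 0 ≤ c * (Real.exp r - 1) := mul_nonneg c.coe_nonneg
      (by linarith [Real.add_one_le_exp (r : ℝ), r.coe_nonneg])
    refine le_trans ?_ (gammaExponent_mono_right c
      (le_top (a := ((c * (Real.exp r - 1)).toNNReal : ℝ≥0∞))))
    rw [gammaExponent_coe hc, Real.coe_toNNReal _ h0]
    have : 1 + c * (Real.exp r - 1) / c = Real.exp r := by
      have : (c : ℝ) ≠ 0 := by exact_mod_cast hc
      field_simp; ring
    rw [this, Real.log_exp, ENNReal.ofReal_coe_nnreal]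
  lift b to ℝ≥0 using hb
  exact top_le_iff.1 ((key (b + 1) (by positivity)).ge.trans (gammaExponent_anti_left (by simp) _))

lemma gammaExponent_zero_left {s : ℝ≥0∞} (hs : s ≠ 0) : gammaExponent 0 s = ⊤ := by
  have key : ∀ c : ℝ≥0, c ≠ 0 → gammaExponent 0 c = ⊤ := by
    intro c hc
    refine ENNReal.eq_top_of_forall_nnreal_le fun r => ?_
    have hr : 0 < Real.exp (r + 1) - 1 := by
      linarith [Real.add_one_le_exp ((r : ℝ) + 1), r.coe_nonneg]
    have hc' : (0 : ℝ) < c := by positivity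
    have h0 : 0 < c / (Real.exp (r + 1) - 1) := by positivity
    refine le_trans ?_ (gammaExponent_anti_left
      (zero_le (a := ((c / (Real.exp (r + 1) - 1)).toNNReal : ℝ≥0∞))) c)
    rw [gammaExponent_coe (by rw [ne_eq, Real.toNNReal_eq_zero, not_le]; exact h0),
      Real.coe_toNNReal _ h0.le]
    have : 1 + c / (c / (Real.exp (r + 1) - 1)) = Real.exp (r + 1) := by
      field_simp; ring
    rw [this, Real.log_exp, ← ENNReal.ofReal_coe_nnreal]
    exact ENNReal.ofReal_le_ofReal (by linarith)
  by_cases h : s = ⊤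
  · rw [h, gammaExponent_top_right (by simp)]
  · lift s to ℝ≥0 using h
    exact key s (by simpa using hs)

/-- Scaling jumps by `w` turns the density `exp (-v) v⁻¹` into `exp (-v / w) v⁻¹`. -/
lemma gammaExponent_inv (w s : ℝ≥0) :
    gammaExponent (w : ℝ≥0∞)⁻¹ s = gammaExponent 1 ((s * w : ℝ≥0) : ℝ≥0∞) := by
  by_cases hw : w = 0
  · simp [hw, gammaExponent_top_left, gammaExponent_zero_right]
  · rw [← ENNReal.coe_inv hw, gammaExponent_coe (inv_ne_zero hw), gammaExponent_one]
    simp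

lemma gammaExponent_mul {b : ℝ≥0} (hb : b ≠ 0) (s : ℝ≥0) :
    gammaExponent b ((s * b : ℝ≥0) : ℝ≥0∞) = gammaExponent 1 s := by
  rw [gammaExponent_coe hb, gammaExponent_one]
  have : (b : ℝ) ≠ 0 := by exact_mod_cast hb
  simp [this]

/-! ### The Laplace functional of an increasing additive process -/

section LevyExponent

variable {ν : Measure (ℝ × ℝ)}

@[simp] lemma levyExponent_zero : levyExponent ν (fun _ => 0) = 0 := by simp [levyExponent]

lemma levyExponent_mono {f g : ℝ → ℝ≥0∞} (h : ∀ x, f x ≤ g x) :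
    levyExponent ν f ≤ levyExponent ν g := by
  unfold levyExponent
  gcongr with p
  exact expNeg_strictAnti.antitone (by gcongr; exact h _)

lemma levyExponent_indicator {B : Set ℝ} (hB : MeasurableSet B) (r : ℝ≥0) :
    levyExponent ν (B.indicator fun _ => (r : ℝ≥0∞)) =
      ∫⁻ p in B ×ˢ Ioi (0 : ℝ), ENNReal.ofReal (1 - Real.exp (-(r * p.2))) ∂ν := by
  have hS : MeasurableSet (univ ×ˢ Ioi (0 : ℝ) : Set (ℝ × ℝ)) :=
    MeasurableSet.univ.prod measurableSet_Ioi
  have hB' : MeasurableSet (Prod.fst ⁻¹' B : Set (ℝ × ℝ)) := measurable_fst hB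
  have : B ×ˢ Ioi (0 : ℝ) = Prod.fst ⁻¹' B ∩ univ ×ˢ Ioi (0 : ℝ) := by ext p; simp
  rw [this, ← Measure.restrict_restrict hB', ← lintegral_indicator hB', levyExponent]
  refine setLIntegral_congr_fun hS fun p hp => ?_
  have hp2 : 0 < p.2 := hp.2
  by_cases h : p.1 ∈ B
  · rw [indicator_of_mem h, indicator_of_mem (show p ∈ Prod.fst ⁻¹' B from h),
      show (r : ℝ≥0∞) * ENNReal.ofReal p.2 = ENNReal.ofReal (r * p.2) by
        rw [ENNReal.ofReal_mul r.coe_nonneg, ENNReal.ofReal_coe_nnreal],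
      expNeg_ofReal (by positivity)]
  · rw [indicator_of_notMem h, indicator_of_notMem (show p ∉ Prod.fst ⁻¹' B from h)]
    simp

/-- The exponent is additive on functions with disjoint supports; this is what makes the masses of
disjoint sets independent. -/
lemma levyExponent_add {f g : ℝ → ℝ≥0∞} (hf : Measurable f) (h : ∀ x, f x = 0 ∨ g x = 0) :
    levyExponent ν (fun x => f x + g x) = levyExponent ν f + levyExponent ν g := by
  unfold levyExponent
  have hm : Measurable fun p : ℝ × ℝ => ENNReal.ofReal (1 - expNeg (f p.1 * ENNReal.ofReal p.2)) :=
    measurable_one_sub_expNeg (hf.comp measurable_fst) measurable_snd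
  rw [← lintegral_add_left hm]
  refine lintegral_congr fun p => ?_
  rcases h p.1 with h | h <;> simp [h]

lemma levyExponent_finsetSum {ι : Type*} {f : ι → ℝ → ℝ≥0∞} (hf : ∀ i, Measurable (f i))
    (s : Finset ι) (h : ∀ i j, i ≠ j → ∀ x, f i x = 0 ∨ f j x = 0) :
    levyExponent ν (fun x => ∑ i ∈ s, f i x) = ∑ i ∈ s, levyExponent ν (f i) := by
  classical
  induction s using Finset.induction_on with
  | empty => simp
  | insert i s hi ih =>
    simp_rw [Finset.sum_insert hi]
    rw [levyExponent_add (hf i) (fun x => ?_), ih]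
    by_cases hx : f i x = 0
    · exact Or.inl hx
    · refine Or.inr (Finset.sum_eq_zero fun j hj => ?_)
      exact (h i j (fun e => hi (e ▸ hj)) x).resolve_left hx

end LevyExponent

section LaplaceFunctional

variable {Ω : Type u} [MeasurableSpace Ω] {P : Measure Ω} {ν : Measure (ℝ × ℝ)}
  {M : Ω → Measure ℝ}

/-- The identity `E exp (-∫ f dM) = exp (-∫ (1 - exp (-f(x) v)) ν(dx dv))` for the random measure
`M` and the function `f`. -/
def HasLaplaceAt (ν : Measure (ℝ × ℝ)) (M : Ω → Measure ℝ) (P : Measure Ω) (f : ℝ → ℝ≥0∞) : Prop :=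
  ∫ ω, expNeg (∫⁻ x, f x ∂M ω) ∂P = expNeg (levyExponent ν f)

lemma aemeasurable_lintegral_randomMeasure (hM : AEMeasurable M P) {f : ℝ → ℝ≥0∞}
    (hf : Measurable f) : AEMeasurable (fun ω => ∫⁻ x, f x ∂M ω) P :=
  (Measure.measurable_lintegral hf).comp_aemeasurable hM

lemma HasLaplaceAt.of_tendsto [IsFiniteMeasure P] (hM : AEMeasurable M P) {f : ℕ → ℝ → ℝ≥0∞}
    {g : ℝ → ℝ≥0∞} (hf : ∀ n, Measurable (f n)) (h : ∀ n, HasLaplaceAt ν M P (f n))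
    (h1 : ∀ᵐ ω ∂P, Tendsto (fun n => ∫⁻ x, f n x ∂M ω) atTop (𝓝 (∫⁻ x, g x ∂M ω)))
    (h2 : Tendsto (fun n => levyExponent ν (f n)) atTop (𝓝 (levyExponent ν g))) :
    HasLaplaceAt ν M P g := by
  have h3 := tendsto_integral_expNeg
    (fun n => aemeasurable_lintegral_randomMeasure hM (hf n)) h1
  have h4 := (continuous_expNeg.tendsto _).comp h2
  refine tendsto_nhds_unique h3 (h4.congr fun n => (h n).symm)

/-- Extension of the Laplace functional along increasing sequences. -/
lemma HasLaplaceAt.of_monotone [IsFiniteMeasure P] (hM : AEMeasurable M P) {f : ℕ → ℝ → ℝ≥0∞}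
    {g : ℝ → ℝ≥0∞} (hf : ∀ n, Measurable (f n)) (h : ∀ n, HasLaplaceAt ν M P (f n))
    (hmono : ∀ x, Monotone fun n => f n x)
    (hlim : ∀ x, Tendsto (fun n => f n x) atTop (𝓝 (g x))) : HasLaplaceAt ν M P g := by
  refine .of_tendsto hM hf h (ae_of_all _ fun ω => lintegral_tendsto_of_tendsto_of_monotone
    (fun n => (hf n).aemeasurable) (ae_of_all _ hmono) (ae_of_all _ hlim)) ?_
  refine lintegral_tendsto_of_tendsto_of_monotone (fun n => (measurable_one_sub_expNeg
    ((hf n).comp measurable_fst) measurable_snd).aemeasurable) (ae_of_all _ fun p m n hmn => ?_)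
    (ae_of_all _ fun p => ?_)
  · refine ENNReal.ofReal_le_ofReal (sub_le_sub_left (expNeg_strictAnti.antitone ?_) _)
    gcongr
    exact hmono _ hmn
  · refine ENNReal.tendsto_ofReal (((continuous_expNeg.tendsto _).comp ?_).const_sub _)
    exact ENNReal.Tendsto.mul_const (hlim _) (Or.inr ENNReal.ofReal_ne_top)

/-- Extension of the Laplace functional along dominated almost everywhere convergent sequences. -/
lemma HasLaplaceAt.of_dominated [IsFiniteMeasure P] (hM : AEMeasurable M P) {f : ℕ → ℝ → ℝ≥0∞}
    {g b : ℝ → ℝ≥0∞} (hf : ∀ n, Measurable (f n)) (h : ∀ n, HasLaplaceAt ν M P (f n))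
    (hb : ∀ n x, f n x ≤ b x) (hbM : ∀ᵐ ω ∂P, ∫⁻ x, b x ∂M ω ≠ ⊤) (hbν : levyExponent ν b ≠ ⊤)
    (h1 : ∀ᵐ ω ∂P, ∀ᵐ x ∂M ω, Tendsto (fun n => f n x) atTop (𝓝 (g x)))
    (h2 : ∀ᵐ p ∂ν, Tendsto (fun n => f n p.1) atTop (𝓝 (g p.1))) : HasLaplaceAt ν M P g := by
  refine .of_tendsto hM hf h ?_ ?_
  · filter_upwards [hbM, h1] with ω hω hω1
    exact tendsto_lintegral_of_dominated_convergence b hf (fun n => ae_of_all _ (hb n)) hω hω1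
  · refine tendsto_lintegral_of_dominated_convergence
      (fun p : ℝ × ℝ => ENNReal.ofReal (1 - expNeg (b p.1 * ENNReal.ofReal p.2)))
      (fun n => measurable_one_sub_expNeg ((hf n).comp measurable_fst) measurable_snd)
      (fun n => ae_of_all _ fun p => ?_) hbν
      ((ae_restrict_of_ae h2).mono fun p hp => ?_)
    · refine ENNReal.ofReal_le_ofReal (sub_le_sub_left (expNeg_strictAnti.antitone ?_) _)
      gcongr
      exact hb _ _
    · refine ENNReal.tendsto_ofReal (((continuous_expNeg.tendsto _).comp ?_).const_sub _)
      exact ENNReal.Tendsto.mul_const hp (Or.inr ENNReal.ofReal_ne_top)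

end LaplaceFunctional

section IAP

variable {Ω : Type u} [MeasurableSpace Ω] {P : Measure Ω} {ν : Measure (ℝ × ℝ)}
  {L : ℝ → Ω → ℝ}

lemma IsIAP.ae_isIncreasingPath (hL : IsIAP ν L P) :
    ∀ᵐ ω ∂P, IsIncreasingPath fun x => L x ω := hL.paths

lemma IsIAP.aemeasurable_stieltjes (hL : IsIAP ν L P) :
    AEMeasurable (fun ω => stieltjes fun y => L y ω) P :=
  _root_.aemeasurable_stieltjes hL.measurable hL.ae_isIncreasingPath

lemma IsIAP.levyExponent_Iic_ne_top (hL : IsIAP ν L P) (x : ℝ) (r : ℝ≥0) :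
    levyExponent ν ((Iic x).indicator fun _ => (r : ℝ≥0∞)) ≠ ⊤ := by
  rw [levyExponent_indicator measurableSet_Iic]
  exact hL.exponent_ne_top x r r.coe_nonneg

lemma IsIAP.integral_exp (hL : IsIAP ν L P) (x : ℝ) (r : ℝ≥0) :
    ∫ ω, Real.exp (-(r * L x ω)) ∂P =
      expNeg (levyExponent ν ((Iic x).indicator fun _ => (r : ℝ≥0∞))) := by
  rw [expNeg_of_ne_top (hL.levyExponent_Iic_ne_top x r), hL.laplace x r r.coe_nonneg,
    levyExponent_indicator measurableSet_Iic]

/-- The Laplace transform of an increment. As `L` has no initial time, it is compared with the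
increments over `(-n, a]` and `(-n, b]`, and then `n` tends to infinity. -/
lemma IsIAP.integral_exp_sub [IsProbabilityMeasure P] (hL : IsIAP ν L P) {a b : ℝ} (hab : a ≤ b)
    (r : ℝ≥0) :
    ∫ ω, Real.exp (-(r * (L b ω - L a ω))) ∂P =
      expNeg (levyExponent ν ((Ioc a b).indicator fun _ => (r : ℝ≥0∞))) := by
  have hlim : ∀ x : ℝ, Tendsto
      (fun n : ℕ => ∫ ω, Real.exp (-(r * (L x ω - L (-n) ω))) ∂P) atTop
      (𝓝 (∫ ω, Real.exp (-(r * L x ω)) ∂P)) := by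
    intro x
    have hev : ∀ᶠ n : ℕ in atTop, -(n : ℝ) ≤ x := by
      filter_upwards [eventually_ge_atTop ⌈-x⌉₊] with n hn
      have := (Nat.le_ceil (-x)).trans (by exact_mod_cast hn : ((⌈-x⌉₊ : ℕ) : ℝ) ≤ n)
      linarith
    refine tendsto_integral_filter_of_dominated_convergence (fun _ => 1)
      (Eventually.of_forall fun n => ?_) ?_ (integrable_const _) ?_
    · have := hL.measurable x
      have := hL.measurable (-(n : ℝ))
      exact Measurable.aestronglyMeasurable (by fun_prop)
    · filter_upwards [hev] with n hn
      filter_upwards [hL.ae_isIncreasingPath] with ω hω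
      rw [Real.norm_of_nonneg (Real.exp_nonneg _), Real.exp_le_one_iff, neg_nonpos]
      exact mul_nonneg r.coe_nonneg (sub_nonneg.2 (hω.1 hn))
    · filter_upwards [hL.ae_isIncreasingPath] with ω hω
      have h0 : Tendsto (fun n : ℕ => L (-n) ω) atTop (𝓝 0) :=
        hω.2.2.comp (tendsto_neg_atTop_atBot.comp tendsto_natCast_atTop_atTop)
      have := ((Real.continuous_exp.tendsto _).comp ((h0.const_sub (L x ω)).const_mul (r : ℝ)).neg)
      simpa [Function.comp_def] using this
  have hmul : ∀ᶠ n : ℕ in atTop, (∫ ω, Real.exp (-(r * (L b ω - L (-n) ω))) ∂P) =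
      (∫ ω, Real.exp (-(r * (L a ω - L (-n) ω))) ∂P) *
        ∫ ω, Real.exp (-(r * (L b ω - L a ω))) ∂P := by
    filter_upwards [eventually_ge_atTop ⌈-a⌉₊] with n hn
    have hn : -(n : ℝ) ≤ a := by
      have := (Nat.le_ceil (-a)).trans (by exact_mod_cast hn : ((⌈-a⌉₊ : ℕ) : ℝ) ≤ n)
      linarith
    have hi := hL.indep.indepFun_sub_sub hn hab
    have hi := hi.comp (φ := fun y : ℝ => Real.exp (-(r * y)))
      (ψ := fun y : ℝ => Real.exp (-(r * y))) (by fun_prop) (by fun_prop)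
    have hma := hL.measurable a
    have hmb := hL.measurable b
    have hmn := hL.measurable (-(n : ℝ))
    have := hi.integral_fun_mul_eq_mul_integral
      (Measurable.aestronglyMeasurable (by fun_prop))
      (Measurable.aestronglyMeasurable (by fun_prop))
    simp only [Function.comp_def, Pi.sub_apply] at this
    rw [← this]
    refine integral_congr_ae (ae_of_all _ fun ω => ?_)
    simp only
    rw [← Real.exp_add]
    ring_nf
  have h3 := tendsto_nhds_unique ((hlim b).congr' hmul) ((hlim a).mul_const _)
  rw [hL.integral_exp, hL.integral_exp] at h3
  have hsplit : levyExponent ν ((Iic b).indicator fun _ => (r : ℝ≥0∞)) =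
      levyExponent ν ((Iic a).indicator fun _ => (r : ℝ≥0∞)) +
        levyExponent ν ((Ioc a b).indicator fun _ => (r : ℝ≥0∞)) := by
    rw [← levyExponent_add (measurable_const.indicator measurableSet_Iic) fun x => ?_]
    · congr 1
      ext x
      rw [← Iic_union_Ioc_eq_Iic hab,
        indicator_union_of_disjoint (Iic_disjoint_Ioc le_rfl)]
    · by_cases hx : x ≤ a <;> simp [hx]
  rw [hsplit, expNeg_add] at h3
  refine (mul_left_cancel₀ (fun h0 => ?_) h3).symm
  exact hL.levyExponent_Iic_ne_top a r (expNeg_eq_zero_iff.1 h0)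

/-- The Laplace functional on step functions, from the independence of the increments. -/
lemma IsIAP.hasLaplaceAt_step [IsProbabilityMeasure P] (hL : IsIAP ν L P) {t : ℕ → ℝ}
    (ht : Monotone t) (c : ℕ → ℝ≥0) (N : ℕ) :
    HasLaplaceAt ν (fun ω => stieltjes fun y => L y ω) P
      (fun x => ∑ i ∈ Finset.range N, (Ioc (t i) (t (i + 1))).indicator (fun _ => (c i : ℝ≥0∞)) x)
    := by
  have hm : ∀ i, Measurable fun x => (Ioc (t i) (t (i + 1))).indicator (fun _ => (c i : ℝ≥0∞)) x :=
    fun i => measurable_const.indicator measurableSet_Ioc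
  have hdisj : ∀ i j, i < j → ∀ x, (Ioc (t i) (t (i + 1))).indicator (fun _ => (c i : ℝ≥0∞)) x = 0 ∨
      (Ioc (t j) (t (j + 1))).indicator (fun _ => (c j : ℝ≥0∞)) x = 0 := by
    intro i j hij x
    by_cases hx : x ∈ Ioc (t i) (t (i + 1))
    · refine Or.inr (indicator_of_notMem (fun hx' => ?_) _)
      exact absurd (hx.2.trans (ht (by omega : i + 1 ≤ j))) (not_le.2 hx'.1)
    · exact Or.inl (indicator_of_notMem hx _)
  rw [HasLaplaceAt, levyExponent_finsetSum hm _ fun i j hij x => ?_, expNeg_sum]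
  · simp_rw [← hL.integral_exp_sub (ht (Nat.le_succ _))]
    have hi := (hL.indep.nat ht).precomp (g := ((↑) : Finset.range N → ℕ)) Subtype.val_injective
    have hmL := hL.measurable
    have := hi.integral_fun_prod_comp (f := fun (i : Finset.range N) (y : ℝ) =>
        Real.exp (-(c i * y))) (fun i => by
          exact Measurable.aemeasurable (by fun_prop))
      (fun i => Measurable.aestronglyMeasurable (by fun_prop))
    rw [Finset.prod_coe_sort (Finset.range N) fun i =>
      ∫ ω, Real.exp (-(c i * (L (t (i + 1)) ω - L (t i) ω))) ∂P] at this
    simp only [Nat.succ_eq_add_one]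
    rw [← this]
    refine integral_congr_ae ?_
    filter_upwards [hL.ae_isIncreasingPath] with ω hω
    rw [lintegral_finsetSum _ fun i _ => hm i, expNeg_sum,
      Finset.prod_coe_sort (Finset.range N) fun i =>
        Real.exp (-(c i * (L (t (i + 1)) ω - L (t i) ω)))]
    refine Finset.prod_congr rfl fun i _ => ?_
    have hle := hω.1 (ht (Nat.le_succ i))
    rw [lintegral_indicator_const measurableSet_Ioc, stieltjes_Ioc hω (ht (Nat.le_succ i)),
      ← ENNReal.ofReal_coe_nnreal,
      ← ENNReal.ofReal_mul (c i).coe_nonneg,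
      expNeg_ofReal (mul_nonneg (c i).coe_nonneg (sub_nonneg.2 hle))]
  · rcases lt_or_gt_of_ne hij with h | h
    · exact hdisj i j h x
    · exact (hdisj j i h x).symm

/-- The Laplace functional on continuous functions cut off outside `(-K, K]`, by approximation with
step functions on the grid of mesh `1 / (n + 1)`. -/
lemma IsIAP.hasLaplaceAt_continuous [IsProbabilityMeasure P] (hL : IsIAP ν L P) {g : ℝ → ℝ≥0}
    (hg : Continuous g) {c : ℝ≥0} (hc : ∀ x, g x ≤ c) (K : ℕ) :
    HasLaplaceAt ν (fun ω => stieltjes fun y => L y ω) P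
      ((Ioc (-K : ℝ) K).indicator fun x => (g x : ℝ≥0∞)) := by
  let t : ℕ → ℕ → ℝ := fun n i => -K + i / (n + 1)
  have ht : ∀ n, Monotone (t n) := by
    intro n i j hij
    have : (i : ℝ) ≤ j := by exact_mod_cast hij
    simp only [t]
    gcongr
  let f : ℕ → ℝ → ℝ≥0∞ := fun n x => ∑ i ∈ Finset.range (2 * K * (n + 1)),
    (Ioc (t n i) (t n (i + 1))).indicator (fun _ => (g (t n (i + 1)) : ℝ≥0∞)) x
  have hmem : ∀ n i x, x ∈ Ioc (t n i) (t n (i + 1)) ↔ ⌈(x + K) * (n + 1)⌉₊ = i + 1 := by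
    intro n i x
    have hn : (0 : ℝ) < n + 1 := by positivity
    rw [Nat.ceil_eq_iff (Nat.succ_ne_zero i)]
    simp only [t, mem_Ioc, neg_add_lt_iff_lt_add, ← sub_le_iff_le_add',
      sub_neg_eq_add, ← div_lt_iff₀ hn, ← le_div_iff₀ hn]
    rw [add_comm (K : ℝ) x, Nat.succ_eq_add_one, Nat.add_sub_cancel]
  have hf : ∀ n x, f n x = (Ioc (-K : ℝ) K).indicator
      (fun x => (g (t n ⌈(x + K) * (n + 1)⌉₊) : ℝ≥0∞)) x := by
    intro n x
    have hn : (0 : ℝ) < n + 1 := by positivity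
    by_cases hx : x ∈ Ioc (-K : ℝ) K
    · rw [indicator_of_mem hx]
      have h1 : 0 < ⌈(x + K) * (n + 1)⌉₊ := by
        rw [Nat.ceil_pos]
        exact mul_pos (by linarith [hx.1]) hn
      have h2 : ⌈(x + K) * (n + 1)⌉₊ ≤ 2 * K * (n + 1) := by
        rw [Nat.ceil_le]
        push_cast
        gcongr
        linarith [hx.2]
      obtain ⟨j, hj⟩ := Nat.exists_eq_succ_of_ne_zero h1.ne'
      rw [hj] at h2 ⊢
      simp only [f]
      rw [Finset.sum_eq_single j]
      · rw [indicator_of_mem ((hmem n j x).2 hj)]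
      · intro i _ hij
        refine indicator_of_notMem (fun hx' => hij ?_) _
        have := (hmem n i x).1 hx'
        omega
      · intro hj'
        exact absurd (Finset.mem_range.2 (by omega)) hj'
    · rw [indicator_of_notMem hx]
      refine Finset.sum_eq_zero fun i hi => indicator_of_notMem (fun hx' => hx ?_) _
      have hi' : ((i + 1 : ℕ) : ℝ) ≤ 2 * K * (n + 1) := by
        exact_mod_cast Nat.succ_le_of_lt (Finset.mem_range.1 hi)
      refine ⟨lt_of_le_of_lt ?_ hx'.1, hx'.2.trans ?_⟩
      · simp only [t]
        linarith [show (0 : ℝ) ≤ i / (n + 1) by positivity]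
      · simp only [t]
        have := (div_le_iff₀ hn).2 hi'
        linarith
  have hlim : ∀ x, Tendsto (fun n => f n x) atTop
      (𝓝 ((Ioc (-K : ℝ) K).indicator (fun x => (g x : ℝ≥0∞)) x)) := by
    intro x
    simp_rw [hf]
    by_cases hx : x ∈ Ioc (-K : ℝ) K
    · simp_rw [indicator_of_mem hx]
      refine (ENNReal.continuous_coe.tendsto _).comp ((hg.tendsto x).comp ?_)
      have h0 : Tendsto (fun n : ℕ => x + 1 / ((n : ℝ) + 1)) atTop (𝓝 x) := by
        simpa using tendsto_one_div_add_atTop_nhds_zero_nat.const_add x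
      refine tendsto_of_tendsto_of_tendsto_of_le_of_le tendsto_const_nhds h0 (fun n => ?_)
        fun n => ?_
      · have hn : (0 : ℝ) < n + 1 := by positivity
        have := (le_div_iff₀ hn).2 (Nat.le_ceil ((x + K) * ((n : ℝ) + 1)))
        simp only [t]
        linarith
      · have hn : (0 : ℝ) < n + 1 := by positivity
        have := (div_lt_div_iff_of_pos_right hn).2 (Nat.ceil_lt_add_one
          (a := (x + K) * ((n : ℝ) + 1)) (mul_nonneg (by linarith [hx.1]) hn.le))
        rw [add_div, mul_div_cancel_right₀ _ hn.ne'] at this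
        simp only [t]
        linarith
    · simp_rw [indicator_of_notMem hx]
      exact tendsto_const_nhds
  refine .of_dominated hL.aemeasurable_stieltjes (f := f)
    (b := (Iic (K : ℝ)).indicator fun _ => (c : ℝ≥0∞))
    (fun n => Finset.measurable_fun_sum _ fun i _ => measurable_const.indicator measurableSet_Ioc)
    (fun n => hL.hasLaplaceAt_step (ht n) (fun i => g (t n (i + 1))) _) (fun n x => ?_) ?_
    (hL.levyExponent_Iic_ne_top _ _) (ae_of_all _ fun ω => ae_of_all _ hlim)
    (ae_of_all _ fun p => hlim p.1)
  · rw [hf]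
    by_cases hx : x ∈ Ioc (-K : ℝ) K
    · rw [indicator_of_mem hx, indicator_of_mem (show x ∈ Iic (K : ℝ) from hx.2)]
      exact_mod_cast hc _
    · rw [indicator_of_notMem hx]
      exact zero_le
  · filter_upwards [hL.ae_isIncreasingPath] with ω hω
    rw [lintegral_indicator_const measurableSet_Iic, stieltjes_Iic hω]
    finiteness

/-- The Laplace functional of an increasing additive process whose intensity is absolutely
continuous in the first variable. Bounded measurable functions on `(-K, K]` are limits of continuous
ones, almost everywhere for both `α` and almost every path measure: the density of the bounded
continuous functions is applied in `L¹` of a finite measure which dominates all of these. -/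
theorem IsIAP.hasLaplaceAt [IsProbabilityMeasure P] (hL : IsIAP ν L P) (α : Measure ℝ)
    [IsFiniteMeasure α] (hα : ν.map Prod.fst ≪ α) {f : ℝ → ℝ≥0} (hf : Measurable f) :
    HasLaplaceAt ν (fun ω => stieltjes fun y => L y ω) P fun x => f x := by
  obtain ⟨M, hM, hML⟩ := hL.aemeasurable_stieltjes
  have hbdd : ∀ (K c : ℕ) (f : ℝ → ℝ≥0), Measurable f → (∀ x, f x ≤ c) →
      HasLaplaceAt ν (fun ω => stieltjes fun y => L y ω) P
        ((Ioc (-K : ℝ) K).indicator fun x => (f x : ℝ≥0∞)) := by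
    intro K c f hf hfc
    let S : Set ℝ := Ioc (-K : ℝ) K
    have hS : MeasurableSet S := measurableSet_Ioc
    -- the factor makes `κ` a sub-Markov kernel without changing its null sets; the mixture of the
    -- `κ ω` is then a finite measure whose null sets are null for almost every `κ ω`
    let κ : Ω → Measure ℝ := fun ω => (1 + M ω S)⁻¹ • (M ω).restrict S
    have hκ : Measurable κ := by
      refine Measure.measurable_of_measurable_coe _ fun B hB => ?_
      have h1 := (Measure.measurable_coe hS).comp hM
      have h2 := (Measure.measurable_coe (hB.inter hS)).comp hM
      simp only [κ, Measure.smul_apply, Measure.restrict_apply hB, smul_eq_mul]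
      exact ((h1.const_add 1).inv).mul h2
    have hκ1 : ∀ ω, κ ω univ ≤ 1 := by
      intro ω
      simp only [κ, Measure.smul_apply, Measure.restrict_apply_univ, smul_eq_mul]
      rw [mul_comm, ← div_eq_mul_inv]
      exact ENNReal.div_le_of_le_mul (by rw [one_mul]; exact le_add_self)
    let ρ : Measure ℝ := α + P.bind κ
    have : IsFiniteMeasure (P.bind κ) := by
      refine ⟨?_⟩
      rw [Measure.bind_apply MeasurableSet.univ hκ.aemeasurable]
      calc ∫⁻ ω, κ ω univ ∂P ≤ ∫⁻ _, 1 ∂P := lintegral_mono hκ1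
        _ < ⊤ := by simp
    have hfi : MemLp (fun x => (f x : ℝ)) 1 ρ := by
      refine MemLp.of_bound hf.coe_nnreal_real.aestronglyMeasurable c (ae_of_all _ fun x => ?_)
      rw [Real.norm_of_nonneg (f x).coe_nonneg]
      exact_mod_cast hfc x
    have hex : ∀ n : ℕ, ∃ g : BoundedContinuousFunction ℝ ℝ,
        eLpNorm ((fun x => (f x : ℝ)) - (g : ℝ → ℝ)) 1 ρ ≤ (n : ℝ≥0∞)⁻¹ ∧ MemLp g 1 ρ := fun n =>
      hfi.exists_boundedContinuous_eLpNorm_sub_le ENNReal.one_ne_top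
        (ENNReal.inv_ne_zero.2 (ENNReal.natCast_ne_top n))
    choose g hg1 hg2 using hex
    have hconv : TendstoInMeasure ρ (fun n => (g n : ℝ → ℝ)) atTop fun x => (f x : ℝ) := by
      refine tendstoInMeasure_of_tendsto_eLpNorm one_ne_zero (fun n => (hg2 n).1) hfi.1 ?_
      refine tendsto_of_tendsto_of_tendsto_of_le_of_le tendsto_const_nhds
        ENNReal.tendsto_inv_nat_nhds_zero (fun n => zero_le) fun n => ?_
      rw [eLpNorm_sub_comm]
      exact hg1 n
    obtain ⟨ns, -, hns⟩ := hconv.exists_seq_tendsto_ae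
    -- truncation at `0` and `c` keeps the approximations within the range of `f`
    let g' : ℕ → ℝ → ℝ≥0 := fun n x => min (g (ns n) x).toNNReal c
    have hg'c : ∀ n, Continuous (g' n) := fun n =>
      (continuous_real_toNNReal.comp (g (ns n)).continuous).min continuous_const
    have hlim : ∀ x, (x ∈ S → Tendsto (fun n => g (ns n) x) atTop (𝓝 (f x : ℝ))) →
        Tendsto (fun n => S.indicator (fun x => (g' n x : ℝ≥0∞)) x) atTop
          (𝓝 (S.indicator (fun x => (f x : ℝ≥0∞)) x)) := by
      intro x hx
      by_cases hxS : x ∈ S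
      · simp_rw [indicator_of_mem hxS]
        refine (ENNReal.continuous_coe.tendsto _).comp ?_
        have h1 := ((continuous_real_toNNReal.tendsto _).comp (hx hxS)).min
          (tendsto_const_nhds (x := (c : ℝ≥0)))
        rwa [Real.toNNReal_coe, min_eq_left (hfc x)] at h1
      · simp_rw [indicator_of_notMem hxS]
        exact tendsto_const_nhds
    have hαρ : ∀ᵐ x ∂α, Tendsto (fun n => g (ns n) x) atTop (𝓝 (f x : ℝ)) :=
      ae_mono (Measure.le_add_right le_rfl) hns
    have hκρ : ∀ᵐ ω ∂P, ∀ᵐ x ∂κ ω, Tendsto (fun n => g (ns n) x) atTop (𝓝 (f x : ℝ)) :=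
      Measure.ae_ae_of_ae_bind hκ.aemeasurable (ae_mono (Measure.le_add_left le_rfl) hns)
    refine .of_dominated hL.aemeasurable_stieltjes
      (f := fun n => S.indicator fun x => (g' n x : ℝ≥0∞))
      (b := (Iic (K : ℝ)).indicator fun _ => ((c : ℝ≥0) : ℝ≥0∞))
      (fun n => (ENNReal.continuous_coe.comp (hg'c n)).measurable.indicator hS)
      (fun n => hL.hasLaplaceAt_continuous (hg'c n) (fun x => min_le_right _ _) K)
      (fun n x => ?_) ?_ (hL.levyExponent_Iic_ne_top _ _) ?_ ?_
    · by_cases hx : x ∈ S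
      · rw [indicator_of_mem hx, indicator_of_mem (show x ∈ Iic (K : ℝ) from hx.2)]
        exact ENNReal.coe_le_coe.2 (min_le_right _ _)
      · rw [indicator_of_notMem hx]
        exact zero_le
    · filter_upwards [hL.ae_isIncreasingPath] with ω hω
      rw [lintegral_indicator_const measurableSet_Iic, stieltjes_Iic hω]
      finiteness
    · filter_upwards [hκρ, hML, hL.ae_isIncreasingPath] with ω hω hω' hωp
      have hfin : M ω S ≠ ⊤ := by
        rw [← hω']
        refine ne_top_of_le_ne_top ?_ (measure_mono (Ioc_subset_Iic_self))
        rw [stieltjes_Iic hωp]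
        exact ENNReal.ofReal_ne_top
      simp only [κ] at hω
      rw [Measure.ae_ennreal_smul_measure_iff (ENNReal.inv_ne_zero.2 (by finiteness)),
        ae_restrict_iff' hS] at hω
      rw [hω']
      exact hω.mono hlim
    · exact ae_of_ae_map measurable_fst.aemeasurable (hα (hαρ.mono fun x hx => hlim x fun _ => hx))
  refine .of_monotone hL.aemeasurable_stieltjes
    (f := fun n : ℕ => (Ioc (-n : ℝ) n).indicator fun x => ((min (f x) n : ℝ≥0) : ℝ≥0∞))
    (fun n => (hf.min measurable_const).coe_nnreal_ennreal.indicator measurableSet_Ioc)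
    (fun n => hbdd n n (fun x => min (f x) n) (hf.min measurable_const) fun x => min_le_right _ _)
    (fun x m n hmn => ?_) fun x => ?_
  · have hmn' : (m : ℝ) ≤ n := by exact_mod_cast hmn
    refine (indicator_le_indicator_of_subset (Ioc_subset_Ioc (neg_le_neg hmn') hmn')
      (fun _ => zero_le) x).trans (indicator_le_indicator ?_)
    gcongr
  · refine Tendsto.congr' (f₁ := fun _ => (f x : ℝ≥0∞)) ?_ tendsto_const_nhds
    filter_upwards [eventually_ge_atTop (⌈|x|⌉₊ + 1), eventually_ge_atTop ⌈f x⌉₊] with n hn hn'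
    have h1 : |x| < n := by
      have h1 := Nat.le_ceil |x|
      have h2 : ((⌈|x|⌉₊ + 1 : ℕ) : ℝ) ≤ n := by exact_mod_cast hn
      push_cast at h2
      linarith
    rw [abs_lt] at h1
    rw [indicator_of_mem (show x ∈ Ioc (-n : ℝ) n from ⟨h1.1, h1.2.le⟩),
      min_eq_left ((Nat.le_ceil _).trans (by exact_mod_cast hn'))]

end IAP

/-! ### Completely random measures -/

/-- A random measure `M` on `ℝ` with Poisson intensity `ν`, given by its Laplace functional
`E exp (-∫ f dM) = exp (-∫ (1 - exp (-f(x) v)) ν(dx dv))`. -/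
structure IsCompletelyRandom {Ω : Type u} [MeasurableSpace Ω] (ν : Measure (ℝ × ℝ))
    (M : Ω → Measure ℝ) (P : Measure Ω) : Prop where
  aemeasurable : AEMeasurable M P
  laplace : ∀ f : ℝ → ℝ≥0, Measurable f → HasLaplaceAt ν M P fun x => f x

lemma measurable_withDensity {w : ℝ → ℝ≥0∞} (hw : Measurable w) :
    Measurable fun m : Measure ℝ => m.withDensity w := by
  refine Measure.measurable_of_measurable_coe _ fun B hB => ?_
  simp_rw [withDensity_apply _ hB, ← lintegral_indicator hB]
  exact Measure.measurable_lintegral (hw.indicator hB)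

section

variable {Ω : Type u} [MeasurableSpace Ω] {P : Measure Ω} {ν : Measure (ℝ × ℝ)}
  {M : Ω → Measure ℝ}

lemma ae_eq_zero_of_integral_expNeg [IsProbabilityMeasure P] {Z : Ω → ℝ≥0∞}
    (hZ : AEMeasurable Z P) (h : ∫ ω, expNeg (Z ω) ∂P = 1) : ∀ᵐ ω ∂P, Z ω = 0 := by
  have h1 : ∫ ω, (1 - expNeg (Z ω)) ∂P = 0 := by
    rw [integral_sub (integrable_const _) (integrable_expNeg hZ), h]
    simp
  rw [integral_eq_zero_iff_of_nonneg (fun ω => sub_nonneg.2 (expNeg_le_one _))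
    ((integrable_const _).sub (integrable_expNeg hZ))] at h1
  filter_upwards [h1] with ω hω
  exact expNeg_eq_one_iff.1 (sub_eq_zero.1 hω).symm

lemma ae_eq_top_of_integral_expNeg [IsProbabilityMeasure P] {Z : Ω → ℝ≥0∞}
    (hZ : AEMeasurable Z P) (h : ∫ ω, expNeg (Z ω) ∂P = 0) : ∀ᵐ ω ∂P, Z ω = ⊤ := by
  rw [integral_eq_zero_iff_of_nonneg (fun ω => expNeg_nonneg _) (integrable_expNeg hZ)] at h
  filter_upwards [h] with ω hω
  exact expNeg_eq_zero_iff.1 hω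

/-- The Laplace functional extends to `[0, ∞]`-valued functions. -/
lemma IsCompletelyRandom.hasLaplaceAt [IsFiniteMeasure P] (hM : IsCompletelyRandom ν M P)
    {f : ℝ → ℝ≥0∞} (hf : Measurable f) : HasLaplaceAt ν M P f := by
  refine .of_monotone hM.aemeasurable
    (f := fun (n : ℕ) x => (((min (f x) n).toNNReal : ℝ≥0) : ℝ≥0∞))
    (fun n => (hf.min measurable_const).ennreal_toNNReal.coe_nnreal_ennreal)
    (fun n => hM.laplace _ (hf.min measurable_const).ennreal_toNNReal) (fun x m n hmn => ?_)
    fun x => ?_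
  · simp only
    rw [ENNReal.coe_toNNReal (by simp), ENNReal.coe_toNNReal (by simp)]
    gcongr
  · have : ∀ n : ℕ, (((min (f x) n).toNNReal : ℝ≥0) : ℝ≥0∞) = min (f x) n := fun n =>
      ENNReal.coe_toNNReal (by simp)
    simp_rw [this]
    have h := (tendsto_const_nhds (x := f x)).min ENNReal.tendsto_nat_nhds_top
    rwa [min_eq_left le_top] at h

lemma IsCompletelyRandom.withDensity [IsFiniteMeasure P] (hM : IsCompletelyRandom ν M P)
    {ν' : Measure (ℝ × ℝ)} {w : ℝ → ℝ≥0} (hw : Measurable w)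
    (h : ∀ f : ℝ → ℝ≥0, Measurable f → levyExponent ν (fun x => ((f x * w x : ℝ≥0) : ℝ≥0∞)) =
      levyExponent ν' fun x => f x) :
    IsCompletelyRandom ν' (fun ω => (M ω).withDensity fun x => (w x : ℝ≥0∞)) P where
  aemeasurable := (measurable_withDensity hw.coe_nnreal_ennreal).comp_aemeasurable hM.aemeasurable
  laplace f hf := by
    have h1 := hM.laplace (fun x => f x * w x) (hf.mul hw)
    rw [HasLaplaceAt, h f hf] at h1
    rw [HasLaplaceAt, ← h1]
    refine integral_congr_ae (ae_of_all _ fun ω => ?_)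
    simp only
    rw [lintegral_withDensity_eq_lintegral_mul _ hw.coe_nnreal_ennreal hf.coe_nnreal_ennreal]
    congr 1
    refine lintegral_congr fun x => ?_
    simp [mul_comm]

/-- Two completely random measures with the same intensity have the same law. -/
lemma IsCompletelyRandom.map_eq [IsFiniteMeasure P] (hM : IsCompletelyRandom ν M P)
    {Ω' : Type v} [MeasurableSpace Ω'] {P' : Measure Ω'} [IsFiniteMeasure P'] {M' : Ω' → Measure ℝ}
    (hM' : IsCompletelyRandom ν M' P') : P.map M = P'.map M' :=
  map_eq_of_laplace hM.aemeasurable hM'.aemeasurable fun f hf _ =>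
    (hM.laplace f hf).trans (hM'.laplace f hf).symm

/-- An integral with finite Lévy exponent is almost surely finite: its Laplace transform at `r`
tends to `1` as `r → 0`. -/
lemma IsCompletelyRandom.ae_lintegral_lt_top [IsProbabilityMeasure P]
    (hM : IsCompletelyRandom ν M P) {f : ℝ → ℝ≥0} (hf : Measurable f)
    (h : levyExponent ν (fun x => f x) ≠ ⊤) : ∀ᵐ ω ∂P, ∫⁻ x, f x ∂M ω < ⊤ := by
  classical
  let r : ℕ → ℝ≥0∞ := fun n => ((n : ℝ≥0∞) + 1)⁻¹
  have hr : Tendsto r atTop (𝓝 0) := by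
    have := (tendsto_add_atTop_iff_nat 1).2 ENNReal.tendsto_inv_nat_nhds_zero
    simpa [r] using this
  have hr0 : ∀ n, r n ≠ 0 := fun n => ENNReal.inv_ne_zero.2 (by finiteness)
  have hr1 : ∀ n, r n ≤ 1 := fun n => ENNReal.inv_le_one.2 le_add_self
  let X : Ω → ℝ≥0∞ := fun ω => ∫⁻ x, f x ∂M ω
  have hX : AEMeasurable X P := aemeasurable_lintegral_randomMeasure hM.aemeasurable
    hf.coe_nnreal_ennreal
  let Z : Ω → ℝ≥0∞ := fun ω => if X ω = ⊤ then ⊤ else 0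
  have hlim : ∀ ω, Tendsto (fun n => r n * X ω) atTop (𝓝 (Z ω)) := by
    intro ω
    by_cases hω : X ω = ⊤
    · simp only [Z, hω, if_true, ENNReal.mul_top (hr0 _)]
      exact tendsto_const_nhds
    · simp only [Z, hω, if_false]
      simpa using ENNReal.Tendsto.mul_const hr (Or.inr hω)
  have h1 := tendsto_integral_expNeg (P := P) (fun n => hX.const_mul (r n)) (ae_of_all _ hlim)
  have h2 : ∀ n, ∫ ω, expNeg (r n * X ω) ∂P = expNeg (levyExponent ν fun x => r n * f x) := by
    intro n
    rw [← hM.hasLaplaceAt (hf.coe_nnreal_ennreal.const_mul (r n))]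
    simp_rw [lintegral_const_mul _ hf.coe_nnreal_ennreal]
    rfl
  have h3 : Tendsto (fun n => levyExponent ν fun x => r n * f x) atTop (𝓝 0) := by
    have h4 := tendsto_lintegral_of_dominated_convergence
      (μ := ν.restrict (univ ×ˢ Ioi (0 : ℝ)))
      (F := fun n p => ENNReal.ofReal (1 - expNeg (r n * f p.1 * ENNReal.ofReal p.2)))
      (f := fun _ => 0)
      (fun p : ℝ × ℝ => ENNReal.ofReal (1 - expNeg (f p.1 * ENNReal.ofReal p.2)))
      (fun n => measurable_one_sub_expNeg
        ((hf.coe_nnreal_ennreal.const_mul (r n)).comp measurable_fst) measurable_snd)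
      (fun n => ae_of_all _ fun p => ?_) h (ae_of_all _ fun p => ?_)
    · simpa [levyExponent] using h4
    · refine ENNReal.ofReal_le_ofReal (sub_le_sub_left (expNeg_strictAnti.antitone ?_) _)
      gcongr
      exact mul_le_of_le_one_left zero_le (hr1 n)
    · have h5 : Tendsto (fun n => r n * f p.1 * ENNReal.ofReal p.2) atTop (𝓝 0) := by
        simp_rw [mul_assoc]
        simpa using ENNReal.Tendsto.mul_const hr
          (Or.inr (by finiteness : (f p.1 : ℝ≥0∞) * ENNReal.ofReal p.2 ≠ ⊤))
      have := ENNReal.tendsto_ofReal (((continuous_expNeg.tendsto _).comp h5).const_sub 1)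
      simpa [Function.comp_def] using this
  simp_rw [h2] at h1
  have h4 := (continuous_expNeg.tendsto _).comp h3
  rw [expNeg_zero] at h4
  have h5 := tendsto_nhds_unique h1 h4
  have hZ : AEMeasurable Z P := by
    have : Measurable fun a : ℝ≥0∞ => if a = ⊤ then (⊤ : ℝ≥0∞) else 0 :=
      Measurable.ite (measurableSet_singleton _) measurable_const measurable_const
    exact this.comp_aemeasurable hX
  filter_upwards [ae_eq_zero_of_integral_expNeg hZ h5] with ω hω
  by_contra hc
  have : X ω = ⊤ := top_le_iff.1 (not_lt.1 hc)
  simp [Z, this] at hω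

lemma levyExponent_indicator_top {B : Set ℝ} (hB : MeasurableSet B) :
    levyExponent ν (B.indicator fun _ => ⊤) = ν (B ×ˢ Ioi (0 : ℝ)) := by
  have hS : MeasurableSet (univ ×ˢ Ioi (0 : ℝ) : Set (ℝ × ℝ)) :=
    MeasurableSet.univ.prod measurableSet_Ioi
  have hB' : MeasurableSet (Prod.fst ⁻¹' B : Set (ℝ × ℝ)) := measurable_fst hB
  have : B ×ˢ Ioi (0 : ℝ) = Prod.fst ⁻¹' B ∩ univ ×ˢ Ioi (0 : ℝ) := by ext p; simp
  rw [this, ← Measure.restrict_apply hB', ← lintegral_indicator_one hB', levyExponent]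
  refine setLIntegral_congr_fun hS fun p hp => ?_
  have hp2 : ENNReal.ofReal p.2 ≠ 0 := by simpa using hp.2
  by_cases h : p.1 ∈ B
  · rw [indicator_of_mem h, indicator_of_mem (show p ∈ Prod.fst ⁻¹' B from h),
      ENNReal.top_mul hp2]
    simp
  · rw [indicator_of_notMem h, indicator_of_notMem (show p ∉ Prod.fst ⁻¹' B from h)]
    simp

/-- A set carrying infinitely many jumps has almost surely positive mass. -/
lemma IsCompletelyRandom.ae_ne_zero [IsProbabilityMeasure P] (hM : IsCompletelyRandom ν M P)
    {B : Set ℝ} (hB : MeasurableSet B) (h : ν (B ×ˢ Ioi (0 : ℝ)) = ⊤) :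
    ∀ᵐ ω ∂P, M ω B ≠ 0 := by
  have hm : Measurable (B.indicator fun _ => (⊤ : ℝ≥0∞)) := measurable_const.indicator hB
  have h1 := hM.hasLaplaceAt hm
  rw [HasLaplaceAt, levyExponent_indicator_top hB, h, expNeg_top] at h1
  filter_upwards [ae_eq_top_of_integral_expNeg
    (aemeasurable_lintegral_randomMeasure hM.aemeasurable hm) h1] with ω hω h0
  rw [lintegral_indicator_const hB, h0, mul_zero] at hω
  exact ENNReal.zero_ne_top hω

/-- A completely random measure has independent masses on disjoint sets. -/
lemma IsCompletelyRandom.iIndepFun [IsProbabilityMeasure P] (hM : IsCompletelyRandom ν M P)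
    {ι : Type*} [Fintype ι] {B : ι → Set ℝ} (hB : ∀ i, MeasurableSet (B i))
    (hd : ∀ i j, i ≠ j → Disjoint (B i) (B j)) : iIndepFun (fun i ω => M ω (B i)) P := by
  have hm : ∀ i, AEMeasurable (fun ω => M ω (B i)) P := fun i =>
    (Measure.measurable_coe (hB i)).comp_aemeasurable hM.aemeasurable
  have hpr : ∀ i, IsProbabilityMeasure (P.map fun ω => M ω (B i)) := fun i =>
    Measure.isProbabilityMeasure_map (hm i)
  have hpr' : IsProbabilityMeasure (P.map fun ω i => M ω (B i)) :=
    Measure.isProbabilityMeasure_map (aemeasurable_pi_lambda _ hm)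
  rw [iIndepFun_iff_map_fun_eq_pi_map hm]
  refine ext_of_laplace fun r => ?_
  have hc : Measurable fun a : ι → ℝ≥0∞ => expNeg (∑ i, (r i : ℝ≥0∞) * a i) :=
    measurable_expNeg.comp (by fun_prop)
  have hc1 : ∀ i, Measurable fun a : ℝ≥0∞ => expNeg ((r i : ℝ≥0∞) * a) := fun i =>
    measurable_expNeg.comp (by fun_prop)
  rw [integral_map (aemeasurable_pi_lambda _ hm) hc.aestronglyMeasurable]
  simp_rw [expNeg_sum]
  rw [integral_fintype_prod_eq_prod (fun i a => expNeg ((r i : ℝ≥0∞) * a))]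
  simp_rw [← expNeg_sum]
  have h1 : ∀ i ω, (r i : ℝ≥0∞) * M ω (B i) =
      ∫⁻ x, (B i).indicator (fun _ => (r i : ℝ≥0∞)) x ∂M ω := fun i ω =>
    (lintegral_indicator_const (hB i) _).symm
  have hmi : ∀ i, Measurable ((B i).indicator fun _ => (r i : ℝ≥0∞)) := fun i =>
    measurable_const.indicator (hB i)
  have h2 := hM.hasLaplaceAt (Finset.measurable_fun_sum Finset.univ fun i _ => hmi i)
  rw [HasLaplaceAt, levyExponent_finsetSum hmi _ fun i j hij x => ?_, expNeg_sum] at h2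
  · simp_rw [h1, ← lintegral_finsetSum Finset.univ fun i _ => hmi i]
    rw [h2]
    refine Finset.prod_congr rfl fun i _ => ?_
    rw [integral_map (hm i) (hc1 i).aestronglyMeasurable, ← hM.hasLaplaceAt (hmi i)]
    simp_rw [h1]
  · by_cases hx : x ∈ B i
    · exact Or.inr (indicator_of_notMem (disjoint_left.1 (hd i j hij) hx) _)
    · exact Or.inl (indicator_of_notMem hx _)

/-- An almost surely finite random measure has measurable distribution functions. -/
lemma exists_measurable_distributionFunction (hM : AEMeasurable M P)
    (hfin : ∀ᵐ ω ∂P, M ω univ < ⊤) :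
    ∃ L : ℝ → Ω → ℝ, (∀ x, Measurable (L x)) ∧
      ∀ᵐ ω ∂P, IsFiniteMeasure (M ω) ∧ ∀ x, L x ω = (M ω).real (Iic x) := by
  obtain ⟨M', hM', hMM'⟩ := hM
  refine ⟨fun x ω => (M' ω).real (Iic x), fun x =>
    ((Measure.measurable_coe measurableSet_Iic).comp hM').ennreal_toReal, ?_⟩
  filter_upwards [hMM', hfin] with ω h h'
  exact ⟨⟨h'⟩, fun x => by rw [h]⟩

/-- The distribution functions of an almost surely finite completely random measure form an
increasing additive process. -/
theorem IsCompletelyRandom.exists_isIAP [IsProbabilityMeasure P] (hM : IsCompletelyRandom ν M P)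
    (hν : ∀ r : ℝ≥0, levyExponent ν (fun _ => r) ≠ ⊤) :
    ∃ L : ℝ → Ω → ℝ, IsIAP ν L P ∧ ∀ᵐ ω ∂P, stieltjes (fun y => L y ω) = M ω := by
  have hfin : ∀ᵐ ω ∂P, M ω univ < ⊤ := by
    have := hM.ae_lintegral_lt_top (f := fun _ => 1) measurable_const (hν 1)
    simpa using this
  obtain ⟨L, hLm, hLM⟩ := exists_measurable_distributionFunction hM.aemeasurable hfin
  have hpath : ∀ᵐ ω ∂P, IsIncreasingPath (fun y => L y ω) ∧ stieltjes (fun y => L y ω) = M ω := by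
    filter_upwards [hLM] with ω ⟨h, hω⟩
    exact ⟨by simpa only [hω] using isIncreasingPath_measureReal (M ω),
      stieltjes_eq_of_measureReal hω⟩
  have hfinI : ∀ (B : Set ℝ) (r : ℝ≥0), levyExponent ν (B.indicator fun _ => (r : ℝ≥0∞)) ≠ ⊤ :=
    fun B r => ne_top_of_le_ne_top (hν r)
      (levyExponent_mono fun x => indicator_le_self' (fun _ _ => zero_le) x)
  refine ⟨L, ⟨hLm, hpath.mono fun ω h => h.1, ?_, fun x r hr => ?_, fun x r hr => ?_⟩,
    hpath.mono fun ω h => h.2⟩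
  · intro n t ht
    have hd : ∀ i j : Fin n, i ≠ j → Disjoint (Ioc (t i.castSucc) (t i.succ))
        (Ioc (t j.castSucc) (t j.succ)) := by
      have key : ∀ i j : Fin n, i < j → Disjoint (Ioc (t i.castSucc) (t i.succ))
          (Ioc (t j.castSucc) (t j.succ)) := by
        intro i j hij
        refine Ioc_disjoint_Ioc_of_le (ht ?_)
        exact Fin.succ_le_castSucc_iff.2 hij
      intro i j hij
      rcases lt_or_gt_of_ne hij with h | h
      · exact key i j h
      · exact (key j i h).symm
    have h1 := (hM.iIndepFun (fun i => measurableSet_Ioc) hd).comp (fun _ => ENNReal.toReal)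
      fun _ => ENNReal.measurable_toReal
    refine h1.congr fun i => ?_
    filter_upwards [hLM] with ω ⟨_, hω⟩
    have hle := ht (Fin.castSucc_lt_succ (i := i)).le
    simp only [Function.comp_apply, hω]
    rw [← Iic_sdiff_Iic]
    exact measureReal_sdiff (Iic_subset_Iic.2 hle) measurableSet_Iic
  · lift r to ℝ≥0 using hr
    rw [← levyExponent_indicator measurableSet_Iic]
    exact hfinI _ r
  · lift r to ℝ≥0 using hr
    have hm : Measurable ((Iic x).indicator fun _ => (r : ℝ≥0∞)) :=
      measurable_const.indicator measurableSet_Iic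
    rw [← levyExponent_indicator measurableSet_Iic, ← expNeg_of_ne_top (hfinI _ r),
      ← hM.hasLaplaceAt hm]
    refine integral_congr_ae ?_
    filter_upwards [hLM] with ω ⟨_, hω⟩
    rw [lintegral_indicator_const measurableSet_Iic, hω,
      expNeg_of_ne_top (by finiteness), ENNReal.toReal_mul]
    rfl

end

/-! ### Gamma random measures -/

lemma map_fst_extGammaIntensity (α : Measure ℝ) (β : ℝ → ℝ≥0∞) :
    (extGammaIntensity α β).map Prod.fst ≪ α :=
  ((withDensity_absolutelyContinuous _ _).map measurable_fst).trans
    Measure.quasiMeasurePreserving_fst.absolutelyContinuous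

section

variable {Ω : Type u} [MeasurableSpace Ω] {P : Measure Ω} [IsProbabilityMeasure P]
  {α : Measure ℝ} [IsFiniteMeasure α]

lemma IsExtGammaProcess.isCompletelyRandom {β : ℝ → ℝ≥0∞} {L : ℝ → Ω → ℝ}
    (hL : IsExtGammaProcess α β L P) :
    IsCompletelyRandom (extGammaIntensity α β) (fun ω => stieltjes fun y => L y ω) P where
  aemeasurable := IsIAP.aemeasurable_stieltjes hL
  laplace _ hf := IsIAP.hasLaplaceAt hL α (map_fst_extGammaIntensity α β) hf

lemma IsGammaProcess.isCompletelyRandom {L : ℝ → Ω → ℝ} (hL : IsGammaProcess α L P) :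
    IsCompletelyRandom (gammaIntensity α) (fun ω => stieltjes fun y => L y ω) P := by
  rw [IsGammaProcess, gammaIntensity_eq] at hL
  rw [gammaIntensity_eq]
  exact IsExtGammaProcess.isCompletelyRandom hL

lemma levyExponent_gamma {f : ℝ → ℝ≥0∞} (hf : Measurable f) :
    levyExponent (gammaIntensity α) f = ∫⁻ x, gammaExponent 1 (f x) ∂α := by
  rw [gammaIntensity_eq, levyExponent_extGamma α measurable_const hf]

lemma levyExponent_gamma_const_ne_top (r : ℝ≥0) :
    levyExponent (gammaIntensity α) (fun _ => r) ≠ ⊤ := by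
  rw [levyExponent_gamma measurable_const, gammaExponent_one, lintegral_const]
  finiteness

lemma levyExponent_gamma_indicator {B : Set ℝ} (hB : MeasurableSet B) (r : ℝ≥0) :
    levyExponent (gammaIntensity α) (B.indicator fun _ => (r : ℝ≥0∞)) =
      ENNReal.ofReal (Real.log (1 + r)) * α B := by
  rw [levyExponent_gamma (measurable_const.indicator hB), ← gammaExponent_one,
    ← lintegral_indicator_const hB]
  refine lintegral_congr fun x => ?_
  by_cases hx : x ∈ B <;> simp [hx, gammaExponent_zero_right]

/-- The gamma intensity is infinite over sets of positive `α`-measure with finite rate, since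
`v⁻¹` is not integrable near `0`. For `α B = 0` the right-hand side is `∞ * 0 = 0`. -/
lemma extGammaIntensity_prod_Ioi {β : ℝ → ℝ≥0∞} (hβ : Measurable β) {B : Set ℝ}
    (hB : MeasurableSet B) (hβB : ∀ x ∈ B, β x ≠ ⊤) :
    extGammaIntensity α β (B ×ˢ Ioi (0 : ℝ)) = ⊤ * α B := by
  rw [← levyExponent_indicator_top hB, levyExponent_extGamma α hβ (measurable_const.indicator hB),
    ← lintegral_indicator_const hB]
  refine lintegral_congr fun x => ?_
  by_cases hx : x ∈ B
  · simp [hx, gammaExponent_top_right (hβB x hx)]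
  · simp [hx, gammaExponent_zero_right]

lemma gammaIntensity_prod_Ioi {B : Set ℝ} (hB : MeasurableSet B) :
    gammaIntensity α (B ×ˢ Ioi (0 : ℝ)) = ⊤ * α B := by
  rw [gammaIntensity_eq, extGammaIntensity_prod_Ioi measurable_const hB
    fun _ _ => ENNReal.one_ne_top]

end

/-! ### Dirichlet random distribution functions -/

/-- The gamma distribution with shape `a ≥ 0` and rate `1`, the point mass at `0` for `a = 0`. -/
noncomputable def gammaLaw (a : ℝ) : Measure ℝ :=
  if a = 0 then Measure.dirac 0 else gammaMeasure a 1

lemma isProbabilityMeasure_gammaLaw {a : ℝ} (ha : 0 ≤ a) : IsProbabilityMeasure (gammaLaw a) := by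
  unfold gammaLaw
  split_ifs with h
  · infer_instance
  · exact isProbabilityMeasure_gammaMeasure (lt_of_le_of_ne ha (Ne.symm h)) one_pos

lemma ae_nonneg_gammaLaw (a : ℝ) : ∀ᵐ z ∂gammaLaw a, 0 ≤ z := by
  unfold gammaLaw
  split_ifs with h
  · simp
  · have : {z : ℝ | ¬0 ≤ z} = Iio 0 := by ext z; simp
    rw [ae_iff, this, gammaMeasure, withDensity_apply _ measurableSet_Iio]
    exact lintegral_gammaPDF_of_nonpos le_rfl

/-- The Laplace transform of the gamma distribution, `(1 + r) ^ (-a)`. -/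
lemma integral_exp_gammaLaw {a : ℝ} (ha : 0 ≤ a) (r : ℝ≥0) :
    ∫ z, expNeg (r * ENNReal.ofReal z) ∂gammaLaw a = Real.exp (-(Real.log (1 + r) * a)) := by
  unfold gammaLaw
  split_ifs with h
  · simp [h]
  have ha : 0 < a := lt_of_le_of_ne ha (Ne.symm h)
  have hr : (0 : ℝ) < 1 + r := by positivity
  have hpdf : Measurable (gammaPDF a 1) := (measurable_gammaPDFReal a 1).ennreal_ofReal
  have hm : Measurable fun z : ℝ => expNeg (r * ENNReal.ofReal z) :=
    measurable_expNeg.comp (by fun_prop)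
  rw [integral_eq_lintegral_of_nonneg_ae (ae_of_all _ fun _ => expNeg_nonneg _)
    hm.aestronglyMeasurable, gammaMeasure,
    lintegral_withDensity_eq_lintegral_mul _ hpdf hm.ennreal_ofReal]
  -- exponential tilting of the gamma density changes the rate from `1` to `1 + r`
  have key : ∀ z, (gammaPDF a 1 * fun z => ENNReal.ofReal (expNeg (r * ENNReal.ofReal z))) z =
      ENNReal.ofReal (Real.exp (-(Real.log (1 + r) * a))) * gammaPDF a (1 + r) z := by
    intro z
    simp only [Pi.mul_apply]
    rcases lt_or_ge z 0 with hz | hz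
    · rw [gammaPDF_of_neg hz, gammaPDF_of_neg hz, zero_mul, mul_zero]
    · rw [gammaPDF_of_nonneg hz, gammaPDF_of_nonneg hz,
        show (r : ℝ≥0∞) * ENNReal.ofReal z = ENNReal.ofReal (r * z) by
          rw [ENNReal.ofReal_mul r.coe_nonneg, ENNReal.ofReal_coe_nnreal],
        expNeg_ofReal (by positivity), ← ENNReal.ofReal_mul (by positivity),
        ← ENNReal.ofReal_mul (by positivity), Real.rpow_def_of_pos hr, Real.one_rpow]
      congr 1
      have e1 : Real.exp (-((1 + r) * z)) = Real.exp (-(1 * z)) * Real.exp (-(r * z)) := by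
        rw [← Real.exp_add]; ring_nf
      have e2 : Real.exp (-(Real.log (1 + r) * a)) * Real.exp (Real.log (1 + r) * a) = 1 := by
        rw [← Real.exp_add]; simp
      rw [e1]
      linear_combination (-(1 / Real.Gamma a * z ^ (a - 1) * Real.exp (-(1 * z)) *
        Real.exp (-(r * z)))) * e2
  simp_rw [key]
  rw [lintegral_const_mul' _ _ ENNReal.ofReal_ne_top,
    lintegral_gammaPDF_eq_one ha hr, mul_one, ENNReal.toReal_ofReal (Real.exp_nonneg _)]

section

variable {Ω : Type u} [MeasurableSpace Ω] {P : Measure Ω} [IsProbabilityMeasure P]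
  {α : Measure ℝ} [IsFiniteMeasure α] {M : Ω → Measure ℝ}

/-- The masses of disjoint sets under a gamma random measure are independent and gamma
distributed. -/
lemma IsCompletelyRandom.map_gamma (hM : IsCompletelyRandom (gammaIntensity α) M P)
    {ι : Type*} [Fintype ι] {B : ι → Set ℝ} (hB : ∀ i, MeasurableSet (B i))
    (hd : ∀ i j, i ≠ j → Disjoint (B i) (B j)) :
    P.map (fun ω i => M ω (B i)) =
      (Measure.pi fun i => gammaLaw (α.real (B i))).map fun z i => ENNReal.ofReal (z i) := by
  have hpr : ∀ i, IsProbabilityMeasure (gammaLaw (α.real (B i))) := fun i =>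
    isProbabilityMeasure_gammaLaw measureReal_nonneg
  have hm : AEMeasurable (fun ω i => M ω (B i)) P := aemeasurable_pi_lambda _ fun i =>
    (Measure.measurable_coe (hB i)).comp_aemeasurable hM.aemeasurable
  have hm' : Measurable fun (z : ι → ℝ) i => ENNReal.ofReal (z i) := by fun_prop
  have : IsProbabilityMeasure (P.map fun ω i => M ω (B i)) := Measure.isProbabilityMeasure_map hm
  have : IsProbabilityMeasure ((Measure.pi fun i => gammaLaw (α.real (B i))).map
    fun z i => ENNReal.ofReal (z i)) := Measure.isProbabilityMeasure_map hm'.aemeasurable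
  refine ext_of_laplace fun r => ?_
  have hc : Measurable fun a : ι → ℝ≥0∞ => expNeg (∑ i, (r i : ℝ≥0∞) * a i) :=
    measurable_expNeg.comp (by fun_prop)
  rw [integral_map hm hc.aestronglyMeasurable,
    integral_map hm'.aemeasurable hc.aestronglyMeasurable]
  have h1 : ∀ i ω, (r i : ℝ≥0∞) * M ω (B i) =
      ∫⁻ x, (B i).indicator (fun _ => (r i : ℝ≥0∞)) x ∂M ω := fun i ω =>
    (lintegral_indicator_const (hB i) _).symm
  have hmi : ∀ i, Measurable ((B i).indicator fun _ => (r i : ℝ≥0∞)) := fun i =>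
    measurable_const.indicator (hB i)
  have h2 := hM.hasLaplaceAt (Finset.measurable_fun_sum Finset.univ fun i _ => hmi i)
  rw [HasLaplaceAt, levyExponent_finsetSum hmi _ fun i j hij x => ?_] at h2
  · simp_rw [h1, ← lintegral_finsetSum Finset.univ fun i _ => hmi i]
    rw [h2, expNeg_sum]
    simp_rw [expNeg_sum]
    rw [integral_fintype_prod_eq_prod (fun i a => expNeg ((r i : ℝ≥0∞) * ENNReal.ofReal a))]
    refine Finset.prod_congr rfl fun i _ => ?_
    rw [integral_exp_gammaLaw measureReal_nonneg, levyExponent_gamma_indicator (hB i),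
      expNeg_of_ne_top (by finiteness), ENNReal.toReal_mul, ENNReal.toReal_ofReal
        (Real.log_nonneg (by simp))]
    rfl
  · by_cases hx : x ∈ B i
    · exact Or.inr (indicator_of_notMem (disjoint_left.1 (hd i j hij) hx) _)
    · exact Or.inl (indicator_of_notMem hx _)

lemma measurable_normalize : Measurable fun m : Measure ℝ => (m univ)⁻¹ • m := by
  refine Measure.measurable_of_measurable_coe _ fun B hB => ?_
  simp only [Measure.smul_apply, smul_eq_mul]
  exact (Measure.measurable_coe MeasurableSet.univ).inv.mul (Measure.measurable_coe hB)

/-- A gamma random measure divided by its total mass is a Dirichlet random probability. -/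
theorem IsCompletelyRandom.exists_isDirichletDF (hM : IsCompletelyRandom (gammaIntensity α) M P)
    (hα : α ≠ 0) : ∃ D : ℝ → Ω → ℝ, IsDirichletDF α D P ∧
      ∀ᵐ ω ∂P, stieltjes (fun y => D y ω) = (M ω univ)⁻¹ • M ω := by
  have hfin : ∀ᵐ ω ∂P, M ω univ < ⊤ := by
    have := hM.ae_lintegral_lt_top (f := fun _ => 1) measurable_const
      (levyExponent_gamma_const_ne_top 1)
    simpa using this
  have hpos : ∀ᵐ ω ∂P, M ω univ ≠ 0 := by
    refine hM.ae_ne_zero MeasurableSet.univ ?_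
    rw [gammaIntensity_prod_Ioi MeasurableSet.univ]
    exact ENNReal.top_mul (by simpa using hα)
  have hprob : ∀ᵐ ω ∂P, IsProbabilityMeasure ((M ω univ)⁻¹ • M ω) := by
    filter_upwards [hfin, hpos] with ω h1 h2
    refine ⟨?_⟩
    rw [Measure.smul_apply, smul_eq_mul, ENNReal.inv_mul_cancel h2 h1.ne]
  obtain ⟨D, hDm, hD⟩ := exists_measurable_distributionFunction
    (measurable_normalize.comp_aemeasurable hM.aemeasurable)
    (hprob.mono fun ω h => by simp only [Function.comp_apply]; rw [measure_univ]; simp)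
  have hDM : ∀ᵐ ω ∂P, stieltjes (fun y => D y ω) = (M ω univ)⁻¹ • M ω := by
    filter_upwards [hD] with ω ⟨h, hω⟩
    exact stieltjes_eq_of_measureReal hω
  refine ⟨D, ⟨hDm, ?_, fun n B hB hd hu => ?_⟩, hDM⟩
  · filter_upwards [hD, hprob, hDM] with ω ⟨_, hω⟩ h1 h2
    have hp : IsIncreasingPath fun x => D x ω := by
      have h3 : (fun x => D x ω) = fun x => ((M ω univ)⁻¹ • M ω).real (Iic x) := funext hω
      rw [h3]
      exact isIncreasingPath_measureReal _
    refine ⟨hp.1, hp.2.1, hp.2.2, ?_⟩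
    have h3 := tendsto_of_stieltjes_univ hp (by rw [h2]; exact measure_ne_top _ _)
    rwa [h2, measure_univ, ENNReal.toReal_one] at h3
  · have hψ : Measurable fun (a : Fin n → ℝ≥0∞) i => (a i / ∑ j, a j).toReal :=
      measurable_pi_lambda _ fun i => ((measurable_pi_apply i).div
        (Finset.measurable_fun_sum _ fun j _ => measurable_pi_apply j)).ennreal_toReal
    have hm : AEMeasurable (fun ω i => M ω (B i)) P := aemeasurable_pi_lambda _ fun i =>
      (Measure.measurable_coe (hB i)).comp_aemeasurable hM.aemeasurable
    have hm' : Measurable fun (z : Fin n → ℝ) i => ENNReal.ofReal (z i) := by fun_prop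
    have h1 : P.map (fun ω i => (stieltjes fun y => D y ω).real (B i)) =
        (P.map fun ω i => M ω (B i)).map fun a i => (a i / ∑ j, a j).toReal := by
      rw [AEMeasurable.map_map_of_aemeasurable hψ.aemeasurable hm]
      refine Measure.map_congr ?_
      filter_upwards [hDM] with ω hω
      ext i
      have hsum : M ω univ = ∑ j, M ω (B j) := by
        rw [← hu, measure_iUnion hd hB, tsum_fintype]
      rw [hω, measureReal_ennreal_smul_apply, Measure.real, ← ENNReal.toReal_mul, mul_comm,
        ← div_eq_mul_inv, hsum]
      rfl
    rw [h1, hM.map_gamma hB fun i j hij => hd hij, Measure.map_map hψ hm', dirichletLaw]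
    refine Measure.map_congr ?_
    have hpr : ∀ i, IsProbabilityMeasure (gammaLaw (α.real (B i))) := fun i =>
      isProbabilityMeasure_gammaLaw measureReal_nonneg
    have hz : ∀ᵐ z ∂Measure.pi fun i => gammaLaw (α.real (B i)), ∀ i, 0 ≤ z i :=
      ae_all_iff.2 fun i => (Measure.quasiMeasurePreserving_eval _ i).ae
        (ae_nonneg_gammaLaw _)
    filter_upwards [hz] with z hz
    ext i
    simp only [Function.comp_apply]
    rw [ENNReal.toReal_div, ENNReal.toReal_sum (fun _ _ => ENNReal.ofReal_ne_top),
      ENNReal.toReal_ofReal (hz i)]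
    simp_rw [ENNReal.toReal_ofReal (hz _)]

end

section

variable {Ω : Type u} [MeasurableSpace Ω] {P : Measure Ω} {α : Measure ℝ}

lemma IsDirichletDF.aemeasurable_stieltjes {D : ℝ → Ω → ℝ} (hD : IsDirichletDF α D P) :
    AEMeasurable (fun ω => stieltjes fun y => D y ω) P :=
  _root_.aemeasurable_stieltjes hD.measurable
    (hD.paths.mono fun _ h => ⟨h.1, h.2.1, h.2.2.1⟩)

/-- The Laplace transform of the integral of a simple function `f` is an integral over the Dirichlet
law of the probabilities of the fibres of `f`. -/
lemma IsDirichletDF.integral_expNeg {D : ℝ → Ω → ℝ} (hD : IsDirichletDF α D P) {f : ℝ → ℝ≥0}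
    (hf : Measurable f) {n : ℕ} (e : Fin n ≃ range f) :
    ∫ ω, expNeg (∫⁻ x, f x ∂stieltjes fun y => D y ω) ∂P =
      ∫ a, Real.exp (-∑ i, ((e i : ℝ≥0) : ℝ) * a i)
        ∂dirichletLaw fun i => α.real (f ⁻¹' {(e i : ℝ≥0)}) := by
  have hB : ∀ i, MeasurableSet (f ⁻¹' {(e i : ℝ≥0)}) := fun i => hf (measurableSet_singleton _)
  have hd : Pairwise fun i j => Disjoint (f ⁻¹' {(e i : ℝ≥0)}) (f ⁻¹' {(e j : ℝ≥0)}) := by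
    intro i j hij
    refine Disjoint.preimage f (disjoint_singleton.2 fun h => hij ?_)
    exact e.injective (Subtype.ext h)
  have hu : ⋃ i, f ⁻¹' {(e i : ℝ≥0)} = univ := iUnion_eq_univ_iff.2 fun x =>
    ⟨e.symm ⟨f x, x, rfl⟩, by simp⟩
  have hm : AEMeasurable
      (fun ω i => (stieltjes fun y => D y ω).real (f ⁻¹' {(e i : ℝ≥0)})) P :=
    aemeasurable_pi_lambda _ fun i => ((Measure.measurable_coe (hB i)).comp_aemeasurable
      hD.aemeasurable_stieltjes).ennreal_toReal
  rw [← hD.law n _ hB hd hu, integral_map hm (Measurable.aestronglyMeasurable (by fun_prop))]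
  refine integral_congr_ae ?_
  filter_upwards [hD.paths] with ω hω
  have : IsFiniteMeasure (stieltjes fun y => D y ω) :=
    ⟨by rw [stieltjes_univ_of_isProbDF hω]; exact ENNReal.one_lt_top⟩
  have hfx : ∀ x, (f x : ℝ≥0∞) =
      ∑ i, (f ⁻¹' {(e i : ℝ≥0)}).indicator (fun _ => ((e i : ℝ≥0) : ℝ≥0∞)) x := by
    intro x
    rw [Finset.sum_eq_single (e.symm ⟨f x, x, rfl⟩)]
    · rw [indicator_of_mem (by simp)]
      simp
    · intro i _ hi
      refine indicator_of_notMem (fun hx => hi ?_) _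
      rw [Equiv.eq_symm_apply]
      exact Subtype.ext hx.symm
    · simp
  simp_rw [hfx]
  rw [lintegral_finsetSum _ fun i _ => measurable_const.indicator (hB i)]
  simp_rw [lintegral_indicator_const (hB _)]
  rw [expNeg_of_ne_top (ENNReal.sum_ne_top.2 fun i _ => by finiteness),
    ENNReal.toReal_sum fun i _ => by finiteness]
  simp [ENNReal.toReal_mul, Measure.real]

/-- The law of the random measure of a Dirichlet random distribution function depends on the
parameter only. -/
theorem IsDirichletDF.map_eq [IsFiniteMeasure P] {D : ℝ → Ω → ℝ} (hD : IsDirichletDF α D P)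
    {Ω' : Type v} [MeasurableSpace Ω'] {P' : Measure Ω'} [IsFiniteMeasure P']
    {D' : ℝ → Ω' → ℝ} (hD' : IsDirichletDF α D' P') :
    P.map (fun ω => stieltjes fun y => D y ω) = P'.map fun ω => stieltjes fun y => D' y ω := by
  refine map_eq_of_laplace hD.aemeasurable_stieltjes hD'.aemeasurable_stieltjes fun f hf hfr => ?_
  have := hfr.fintype
  let e := (Fintype.equivFin (range f)).symm
  rw [hD.integral_expNeg hf e, hD'.integral_expNeg hf e]

end

/-! ### Kernels and mixtures -/

section KernelConditions

variable {k : ℝ → ℝ → ℝ≥0} {ν : Measure (ℝ × ℝ)}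

lemma KernelConditions.tendsto_kbar (hk : KernelConditions k ν) (x : ℝ) :
    Tendsto (fun t => k t x) Filter.atTop (𝓝 (kbar k x)) := by
  obtain ⟨c, hc⟩ := hk.atTop x
  rwa [kbar, hc.limUnder_eq]

lemma KernelConditions.le_kbar (hk : KernelConditions k ν) (t x : ℝ) : k t x ≤ kbar k x :=
  (hk.mono x).ge_of_tendsto (hk.tendsto_kbar x) t

lemma KernelConditions.measurable_kbar (hk : KernelConditions k ν) : Measurable (kbar k) :=
  measurable_of_tendsto_metrizable (fun n : ℕ => hk.measurable n) (tendsto_pi_nhds.2 fun x =>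
    (hk.tendsto_kbar x).comp tendsto_natCast_atTop_atTop)

/-- The Lévy exponent of `r w`, in the form in which it occurs in `KernelConditions`. -/
lemma levyExponent_mul_left (w : ℝ → ℝ≥0) {r : ℝ} (hr : 0 ≤ r) :
    levyExponent ν (fun x => ENNReal.ofReal r * w x) = ∫⁻ p in univ ×ˢ Ioi (0 : ℝ),
      ENNReal.ofReal (1 - Real.exp (-(r * p.2 * (w p.1 : ℝ)))) ∂ν := by
  refine setLIntegral_congr_fun (MeasurableSet.univ.prod measurableSet_Ioi) fun p hp => ?_
  have hp2 : 0 < p.2 := hp.2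
  rw [show ENNReal.ofReal r * (w p.1 : ℝ≥0∞) * ENNReal.ofReal p.2 =
      ENNReal.ofReal (r * p.2 * w p.1) by
    rw [ENNReal.ofReal_mul (by positivity), ENNReal.ofReal_mul hr, ENNReal.ofReal_coe_nnreal]
    ring, expNeg_ofReal (by positivity)]

lemma setOf_pos_kbar_eq : {p : ℝ × ℝ | 0 < p.2 ∧ 0 < kbar k p.1} =
    {x | 0 < kbar k x} ×ˢ Ioi (0 : ℝ) := by
  ext p
  simp [and_comm]

lemma KernelConditions.levyExponent_ne_top (hk : KernelConditions k ν) {r : ℝ≥0} (hr : 0 < r) :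
    levyExponent ν (fun x => r * kbar k x) ≠ ⊤ := by
  have := (hk.finite r hr).ne
  rwa [← levyExponent_mul_left _ r.coe_nonneg, ENNReal.ofReal_coe_nnreal] at this

lemma measurableSet_pos_kbar (hk : Measurable (kbar k)) : MeasurableSet {x | 0 < kbar k x} :=
  measurableSet_lt measurable_const hk

/-- The normalizing integral `∫ k̄ dM` is almost surely positive and finite. -/
lemma IsCompletelyRandom.ae_drivenTotal {Ω : Type u} [MeasurableSpace Ω] {P : Measure Ω}
    [IsProbabilityMeasure P] {M : Ω → Measure ℝ} (hM : IsCompletelyRandom ν M P)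
    (hk : KernelConditions k ν) :
    ∀ᵐ ω ∂P, 0 < ∫⁻ x, (kbar k x : ℝ≥0∞) ∂M ω ∧ ∫⁻ x, (kbar k x : ℝ≥0∞) ∂M ω < ⊤ := by
  have h1 := hM.ae_lintegral_lt_top hk.measurable_kbar
    (by simpa using hk.levyExponent_ne_top one_pos)
  have h2 := hM.ae_ne_zero (measurableSet_pos_kbar hk.measurable_kbar)
    (setOf_pos_kbar_eq ▸ hk.infinite)
  filter_upwards [h1, h2] with ω h1 h2
  refine ⟨(lintegral_pos_iff_support hk.measurable_kbar.coe_nnreal_ennreal).2 ?_, h1⟩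
  refine pos_iff_ne_zero.2 fun h => h2 ?_
  convert h using 2
  ext x
  simp [pos_iff_ne_zero]

lemma isIncreasingPath_kernel (hk : KernelConditions k ν) (x : ℝ) :
    IsIncreasingPath fun t => (k t x : ℝ) :=
  ⟨fun _ _ h => NNReal.coe_le_coe.2 (hk.mono x h),
    fun t => (NNReal.continuous_coe.tendsto _).comp (hk.rightCont x t),
    by simpa [Function.comp_def] using (NNReal.continuous_coe.tendsto _).comp (hk.atBot x)⟩

/-- Passing to the normalized kernel `k / k̄` and to the random measure `k̄ dM / ∫ k̄ dM` does not
change the normalized random distribution function. -/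
lemma KernelConditions.toReal_div_eq_integral (hk : KernelConditions k ν) (m : Measure ℝ) (t : ℝ) :
    ((∫⁻ x, (k t x : ℝ≥0∞) ∂m) / ∫⁻ x, (kbar k x : ℝ≥0∞) ∂m).toReal =
      ∫ x, (k t x : ℝ) / kbar k x ∂((m.withDensity fun x => (kbar k x : ℝ≥0∞)) univ)⁻¹ •
        m.withDensity fun x => (kbar k x : ℝ≥0∞) := by
  have hmk := hk.measurable_kbar
  have hmt := hk.measurable t
  have hm : Measurable fun x => (k t x : ℝ) / kbar k x := by fun_prop
  rw [integral_eq_lintegral_of_nonneg_ae (ae_of_all _ fun x => by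
      simp only [Pi.zero_apply]; positivity)
    hm.aestronglyMeasurable, lintegral_smul_measure,
    lintegral_withDensity_eq_lintegral_mul _ hmk.coe_nnreal_ennreal hm.ennreal_ofReal,
    withDensity_apply _ MeasurableSet.univ, Measure.restrict_univ, smul_eq_mul, mul_comm,
    ← div_eq_mul_inv]
  congr 2
  refine lintegral_congr fun x => ?_
  simp only [Pi.mul_apply]
  by_cases h : kbar k x = 0
  · have : k t x = 0 := le_antisymm (h ▸ hk.le_kbar t x) zero_le
    simp [h, this]
  · rw [← NNReal.coe_div, ENNReal.ofReal_coe_nnreal, ← ENNReal.coe_mul, mul_div_cancel₀ _ h]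

lemma isIncreasingPath_normalizedKernel (hk : KernelConditions k ν) (x : ℝ) :
    IsIncreasingPath fun t => (k t x : ℝ) / kbar k x := by
  have h := isIncreasingPath_kernel hk x
  refine ⟨fun s t hst => ?_, fun t => (h.2.1 t).div_const _, by simpa using h.2.2.div_const _⟩
  have := h.1 hst
  simp only at this ⊢
  gcongr

/-- The kernel `x ↦ d(k(·, x) / k̄(x))`. It is a probability measure where `k̄(x) > 0`; where
`k̄(x) = 0` it is the zero measure, as division by zero gives `0`. -/
noncomputable def mixingKernel (k : ℝ → ℝ → ℝ≥0) (x : ℝ) : Measure ℝ :=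
  stieltjes fun t => (k t x : ℝ) / kbar k x

lemma normalizedKernel_le_one (hk : KernelConditions k ν) (t x : ℝ) :
    (k t x : ℝ) / kbar k x ≤ 1 :=
  div_le_one_of_le₀ (NNReal.coe_le_coe.2 (hk.le_kbar t x)) (kbar k x).coe_nonneg

lemma mixingKernel_univ_le (hk : KernelConditions k ν) (x : ℝ) : mixingKernel k x univ ≤ 1 := by
  have := tendsto_measure_iUnion_atTop (μ := mixingKernel k x) (s := fun y : ℝ => Iic y)
    (fun i j hij => Iic_subset_Iic.2 hij)
  rw [iUnion_Iic] at this
  refine le_of_tendsto' this fun t => ?_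
  simp only [Function.comp_apply, mixingKernel]
  rw [stieltjes_Iic (isIncreasingPath_normalizedKernel hk x)]
  exact ENNReal.ofReal_le_one.2 (normalizedKernel_le_one hk t x)

lemma measurable_mixingKernel (hk : KernelConditions k ν) : Measurable (mixingKernel k) := by
  have hfin : ∀ x, IsFiniteMeasure (mixingKernel k x) := fun x =>
    ⟨(mixingKernel_univ_le hk x).trans_lt ENNReal.one_lt_top⟩
  have hmk := hk.measurable_kbar
  have hI : ∀ t : ℝ, Measurable fun x => mixingKernel k x (Iic t) := by
    intro t
    have hmt := hk.measurable t
    simp only [mixingKernel, stieltjes_Iic (isIncreasingPath_normalizedKernel hk _)]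
    fun_prop
  refine Measurable.measure_of_isPiSystem (S := range Iic)
    (borel_eq_generateFrom_Iic ℝ ▸ BorelSpace.measurable_eq) isPiSystem_Iic ?_ ?_
  · rintro _ ⟨t, rfl⟩
    exact hI t
  · have : ∀ x, Tendsto (fun n : ℕ => mixingKernel k x (Iic (n : ℝ))) atTop
        (𝓝 (mixingKernel k x univ)) := by
      intro x
      have := tendsto_measure_iUnion_atTop (μ := mixingKernel k x) (s := fun y : ℝ => Iic y)
        (fun i j hij => Iic_subset_Iic.2 hij)
      rw [iUnion_Iic] at this
      exact this.comp tendsto_natCast_atTop_atTop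
    exact measurable_of_tendsto_metrizable (fun n : ℕ => hI n) (tendsto_pi_nhds.2 this)

/-- The mixture `t ↦ ∫ k(t, x) / k̄(x) dm(x)` has Lebesgue-Stieltjes measure
`∫ d(k(·, x) / k̄(x)) dm(x)`. -/
lemma stieltjes_mixture (hk : KernelConditions k ν) (m : Measure ℝ) [IsFiniteMeasure m] :
    stieltjes (fun t => ∫ x, (k t x : ℝ) / kbar k x ∂m) = m.bind (mixingKernel k) := by
  have hmκ := measurable_mixingKernel hk
  have hmk := hk.measurable_kbar
  have : IsFiniteMeasure (m.bind (mixingKernel k)) := by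
    refine ⟨?_⟩
    rw [Measure.bind_apply MeasurableSet.univ hmκ.aemeasurable]
    calc ∫⁻ x, mixingKernel k x univ ∂m ≤ ∫⁻ _, 1 ∂m := lintegral_mono (mixingKernel_univ_le hk)
      _ < ⊤ := by simp
  refine stieltjes_eq_of_measureReal fun t => ?_
  have hmt := hk.measurable t
  have hm : Measurable fun x => (k t x : ℝ) / kbar k x := by fun_prop
  rw [integral_eq_lintegral_of_nonneg_ae (ae_of_all _ fun x => by
      simp only [Pi.zero_apply]; positivity)
    hm.aestronglyMeasurable, Measure.real, Measure.bind_apply measurableSet_Iic hmκ.aemeasurable]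
  simp only [mixingKernel, stieltjes_Iic (isIncreasingPath_normalizedKernel hk _)]

/-- The fundamental theorem of calculus for the Lebesgue-Stieltjes measure: `df = f'(t) dt`. -/
lemma AbsolutelyContinuousOnInterval.stieltjes_eq_withDensity {f : ℝ → ℝ}
    (hf : IsIncreasingPath f) (hac : ∀ a b, AbsolutelyContinuousOnInterval f a b) :
    stieltjes f = volume.withDensity fun t => ENNReal.ofReal (deriv f t) := by
  refine Measure.ext_of_Ioc' _ _ (fun a b hab => ?_) fun a b hab => ?_
  · rw [stieltjes_Ioc hf hab.le]
    exact ENNReal.ofReal_ne_top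
  · rw [stieltjes_Ioc hf hab.le, withDensity_apply _ measurableSet_Ioc,
      ← (hac a b).integral_deriv_eq_sub, intervalIntegral.integral_of_le hab.le,
      ofReal_integral_eq_lintegral_ofReal (hac a b).intervalIntegrable_deriv.1
        (ae_of_all _ fun t => hf.1.deriv_nonneg)]

/-- For absolutely continuous `k(·, x)`, the function `k̄(x)⁻¹ h(x)` is the integral of `g` against
`d(k(·, x) / k̄(x))`. Without absolute convergence both sides are `0`. -/
lemma integral_mixingKernel (hk : KernelConditions k ν)
    (hac : ∀ x a b, AbsolutelyContinuousOnInterval (fun t => (k t x : ℝ)) a b) (g : ℝ → ℝ)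
    (x : ℝ) : ∫ t, g t ∂mixingKernel k x = (kbar k x : ℝ)⁻¹ * meanKernel k g x := by
  have e : (fun t => (k t x : ℝ) / kbar k x) = fun t => (kbar k x : ℝ)⁻¹ * k t x := by
    ext t; rw [div_eq_inv_mul]
  have hp := isIncreasingPath_normalizedKernel hk x
  have hd : ∀ t, deriv (fun t => (k t x : ℝ) / kbar k x) t =
      (kbar k x : ℝ)⁻¹ * deriv (fun s => (k s x : ℝ)) t := by
    intro t
    rw [e, deriv_const_mul_field]
  have h0 : ∀ t, 0 ≤ deriv (fun t => (k t x : ℝ) / kbar k x) t := fun t => hp.1.deriv_nonneg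
  rw [mixingKernel, AbsolutelyContinuousOnInterval.stieltjes_eq_withDensity hp fun a b => by
    rw [e]; exact (hac x a b).const_mul _,
    integral_withDensity_eq_integral_toReal_smul (measurable_deriv _).ennreal_ofReal
      (ae_of_all _ fun _ => ENNReal.ofReal_lt_top), meanKernel, ← integral_const_mul]
  refine integral_congr_ae (ae_of_all _ fun t => ?_)
  simp only
  rw [ENNReal.toReal_ofReal (h0 t), hd, smul_eq_mul]
  ring

lemma measurable_inv_kbar_mul_meanKernel (hk : KernelConditions k ν)
    (hac : ∀ x a b, AbsolutelyContinuousOnInterval (fun t => (k t x : ℝ)) a b) {g : ℝ → ℝ}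
    (hg : Measurable g) : Measurable fun x => (kbar k x : ℝ)⁻¹ * meanKernel k g x := by
  simp_rw [← integral_mixingKernel hk hac]
  exact (measurable_integral_measure hg).comp (measurable_mixingKernel hk)

/-- The mean of a mixture, by Fubini's theorem. -/
lemma integral_stieltjes_mixture (hk : KernelConditions k ν)
    (hac : ∀ x a b, AbsolutelyContinuousOnInterval (fun t => (k t x : ℝ)) a b) {g : ℝ → ℝ}
    (m : Measure ℝ) [IsFiniteMeasure m]
    (hi : Integrable g (stieltjes fun t => ∫ x, (k t x : ℝ) / kbar k x ∂m)) :
    Integrable (fun x => (kbar k x : ℝ)⁻¹ * meanKernel k g x) m ∧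
      ∫ t, g t ∂(stieltjes fun t => ∫ x, (k t x : ℝ) / kbar k x ∂m) =
        ∫ x, (kbar k x : ℝ)⁻¹ * meanKernel k g x ∂m := by
  let κ : Kernel ℝ ℝ := ⟨mixingKernel k, measurable_mixingKernel hk⟩
  have : IsFiniteKernel κ := ⟨⟨1, ENNReal.one_lt_top, mixingKernel_univ_le hk⟩⟩
  have hm : stieltjes (fun t => ∫ x, (k t x : ℝ) / kbar k x ∂m) = (κ ∘ₖ Kernel.const Unit m) () :=
    (stieltjes_mixture hk m).trans (Measure.comp_eq_comp_const_apply (κ := κ))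
  rw [hm] at hi ⊢
  have h1 := hi.integral_comp
  have h2 := Kernel.integral_comp hi
  rw [Kernel.const_apply] at h1 h2
  have h3 : (fun x => (kbar k x : ℝ)⁻¹ * meanKernel k g x) = fun x => ∫ t, g t ∂κ x :=
    funext fun x => (integral_mixingKernel hk hac g x).symm
  rw [h3]
  exact ⟨h1, h2⟩

end KernelConditions

/-! ### Representations of normalized random distribution functions -/

/-- Measurable functionals of random measures with the same law are identically distributed. -/
lemma identDistrib_of_map_eq {Ω : Type u} {Ω' : Type v} [MeasurableSpace Ω] [MeasurableSpace Ω']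
    {P : Measure Ω} {P' : Measure Ω'} {M : Ω → Measure ℝ} {M' : Ω' → Measure ℝ}
    (hM : AEMeasurable M P) (hM' : AEMeasurable M' P') (h : P.map M = P'.map M')
    {γ : Type*} [MeasurableSpace γ] {Φ : Measure ℝ → γ} (hΦ : Measurable Φ) {X : Ω → γ}
    {Y : Ω' → γ} (hX : ∀ᵐ ω ∂P, X ω = Φ (M ω)) (hY : ∀ᵐ ω ∂P', Y ω = Φ (M' ω)) :
    IdentDistrib X Y P P' where
  aemeasurable_fst := (hΦ.comp_aemeasurable hM).congr (hX.mono fun _ h => h.symm)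
  aemeasurable_snd := (hΦ.comp_aemeasurable hM').congr (hY.mono fun _ h => h.symm)
  map_eq := by
    rw [Measure.map_congr hX, Measure.map_congr hY]
    change P.map (Φ ∘ M) = P'.map (Φ ∘ M')
    rw [← AEMeasurable.map_map_of_aemeasurable hΦ.aemeasurable hM,
      ← AEMeasurable.map_map_of_aemeasurable hΦ.aemeasurable hM', h]

section ScaledByRate

variable {Ω : Type u} [MeasurableSpace Ω] {P : Measure Ω} {α : Measure ℝ}
  [IsFiniteMeasure α] {k : ℝ → ℝ → ℝ≥0} {β : ℝ → ℝ≥0}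

/-- The rate of an extended gamma process is positive almost everywhere, since jumps of rate `0`
have infinite Lévy exponent. -/
lemma IsExtGammaProcess.measure_rate_eq_zero {L : ℝ → Ω → ℝ} (hβ : Measurable β)
    (hL : IsExtGammaProcess α (fun x => (β x : ℝ≥0∞)) L P) : α {x | β x = 0} = 0 := by
  have h0 : MeasurableSet {x | β x = 0} := hβ (measurableSet_singleton 0)
  have h1 : ∀ n : ℕ, α ({x | β x = 0} ∩ Iic (n : ℝ)) = 0 := by
    intro n
    by_contra hn
    refine IsIAP.levyExponent_Iic_ne_top hL (n : ℝ) 1 (top_le_iff.1 ?_)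
    rw [levyExponent_extGamma α hβ.coe_nnreal_ennreal
      (measurable_const.indicator measurableSet_Iic)]
    calc ⊤ = ∫⁻ x, ({x | β x = 0} ∩ Iic (n : ℝ)).indicator (fun _ => ⊤) x ∂α := by
          rw [lintegral_indicator_const (h0.inter measurableSet_Iic), ENNReal.top_mul hn]
      _ ≤ _ := lintegral_mono fun x => indicator_le' (s := {x | β x = 0} ∩ Iic (n : ℝ))
          (f := fun _ => ⊤) (g := fun x => gammaExponent (β x) ((Iic (n : ℝ)).indicator
            (fun _ => ((1 : ℝ≥0) : ℝ≥0∞)) x)) (fun x hx => by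
            rw [show β x = 0 from hx.1, indicator_of_mem hx.2, ENNReal.coe_zero,
              gammaExponent_zero_left (by simp)]) (fun _ _ => zero_le) x
  have hu : {x | β x = 0} = ⋃ n : ℕ, {x | β x = 0} ∩ Iic (n : ℝ) := by
    rw [← inter_iUnion, (iUnion_eq_univ_iff.2 fun x => exists_nat_ge x :
      ⋃ n : ℕ, Iic (n : ℝ) = univ), inter_univ]
  rw [hu]
  exact measure_iUnion_null h1

/-- Multiplying a random measure with gamma jumps of rate `β` by `β` gives gamma jumps of
rate `1`. -/
lemma levyExponent_extGamma_mul (hβ : Measurable β) (h0 : α {x | β x = 0} = 0) {f : ℝ → ℝ≥0}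
    (hf : Measurable f) :
    levyExponent (extGammaIntensity α fun x => (β x : ℝ≥0∞))
      (fun x => ((f x * β x : ℝ≥0) : ℝ≥0∞)) = levyExponent (gammaIntensity α) fun x => f x := by
  rw [levyExponent_gamma hf.coe_nnreal_ennreal, levyExponent_extGamma α hβ.coe_nnreal_ennreal
    (by fun_prop)]
  refine lintegral_congr_ae ?_
  filter_upwards [measure_eq_zero_iff_ae_notMem.1 h0] with x hx
  exact gammaExponent_mul hx _

lemma kbar_div {ν : Measure (ℝ × ℝ)} (hk : KernelConditions k ν) (x : ℝ) :
    kbar (fun t x => k t x / β x) x = kbar k x / β x :=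
  ((hk.tendsto_kbar x).div_const (β x)).limUnder_eq

/-- If `k` is admissible for the extended gamma intensity of rate `β`, then `k / β` is admissible
for the gamma intensity. Division by zero matters only on an `α`-null set. -/
lemma KernelConditions.div (hβ : Measurable β) (h0 : α {x | β x = 0} = 0)
    (hk : KernelConditions k (extGammaIntensity α fun x => (β x : ℝ≥0∞))) :
    KernelConditions (fun t x => k t x / β x) (gammaIntensity α) where
  measurable t := (hk.measurable t).div hβ
  mono x s t hst := by
    have := hk.mono x hst
    simp only at this ⊢
    gcongr
  rightCont x t := (hk.rightCont x t).div_const _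
  atBot x := by simpa using (hk.atBot x).div_const (β x)
  atTop x := ⟨_, (hk.tendsto_kbar x).div_const (β x)⟩
  finite r hr := by
    have hmk := hk.measurable_kbar
    have h1 : levyExponent (gammaIntensity α)
        (fun x => ENNReal.ofReal r * (kbar (fun t x => k t x / β x) x : ℝ≥0∞)) =
        levyExponent (extGammaIntensity α fun x => (β x : ℝ≥0∞))
          (fun x => ENNReal.ofReal r * (kbar k x : ℝ≥0∞)) := by
      rw [levyExponent_gamma (by simp_rw [kbar_div hk]; fun_prop),
        levyExponent_extGamma α hβ.coe_nnreal_ennreal (by fun_prop)]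
      refine lintegral_congr_ae ?_
      filter_upwards [measure_eq_zero_iff_ae_notMem.1 h0] with x hx
      have hx : β x ≠ 0 := hx
      rw [kbar_div hk, ENNReal.ofReal, ← ENNReal.coe_mul, ← ENNReal.coe_mul,
        ← gammaExponent_mul hx, mul_assoc, div_mul_cancel₀ _ hx]
    rw [← levyExponent_mul_left _ hr.le, h1, levyExponent_mul_left _ hr.le]
    exact hk.finite r hr
  infinite := by
    have hmk := hk.measurable_kbar
    have hmk' : Measurable (kbar fun t x => k t x / β x) := by
      rw [funext (kbar_div hk)]
      exact hmk.div hβ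
    have h1 := hk.infinite
    rw [setOf_pos_kbar_eq, extGammaIntensity_prod_Ioi hβ.coe_nnreal_ennreal
      (measurableSet_pos_kbar hmk) fun _ _ => ENNReal.coe_ne_top] at h1
    rw [setOf_pos_kbar_eq, gammaIntensity_prod_Ioi (measurableSet_pos_kbar hmk'), ← h1]
    congr 1
    refine measure_congr ?_
    filter_upwards [measure_eq_zero_iff_ae_notMem.1 h0] with x hx
    have hx : β x ≠ 0 := hx
    refine propext ?_
    change 0 < kbar (fun t x => k t x / β x) x ↔ 0 < kbar k x
    rw [kbar_div hk, div_pos_iff_of_pos_right (pos_iff_ne_zero.2 hx)]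

lemma lintegral_div_withDensity (hβ : Measurable β) {m : Measure ℝ} (h0 : m {x | β x = 0} = 0)
    {f : ℝ → ℝ≥0} (hf : Measurable f) :
    ∫⁻ x, ((f x / β x : ℝ≥0) : ℝ≥0∞) ∂(m.withDensity fun x => (β x : ℝ≥0∞)) =
      ∫⁻ x, (f x : ℝ≥0∞) ∂m := by
  rw [lintegral_withDensity_eq_lintegral_mul _ hβ.coe_nnreal_ennreal (by fun_prop)]
  refine lintegral_congr_ae ?_
  filter_upwards [measure_eq_zero_iff_ae_notMem.1 h0] with x hx
  have hx : β x ≠ 0 := hx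
  simp only [Pi.mul_apply]
  rw [← ENNReal.coe_mul, mul_div_cancel₀ _ hx]

lemma IsCompletelyRandom.ae_eq_zero [IsProbabilityMeasure P] {ν : Measure (ℝ × ℝ)}
    {M : Ω → Measure ℝ} (hM : IsCompletelyRandom ν M P) {B : Set ℝ} (hB : MeasurableSet B)
    (h : ν (B ×ˢ Ioi (0 : ℝ)) = 0) : ∀ᵐ ω ∂P, M ω B = 0 := by
  have hm : Measurable (B.indicator fun _ => (⊤ : ℝ≥0∞)) := measurable_const.indicator hB
  have h1 := hM.hasLaplaceAt hm
  rw [HasLaplaceAt, levyExponent_indicator_top hB, h, expNeg_zero] at h1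
  filter_upwards [ae_eq_zero_of_integral_expNeg
    (aemeasurable_lintegral_randomMeasure hM.aemeasurable hm) h1] with ω hω
  rw [lintegral_indicator_const hB] at hω
  simpa using hω

/-- The gamma process `∫ β dL` driven by an extended gamma process `L` with rate `β`. -/
lemma exists_gammaProcess_of_extGamma [IsProbabilityMeasure P] {L : ℝ → Ω → ℝ} (hβ : Measurable β)
    (hL : IsExtGammaProcess α (fun x => (β x : ℝ≥0∞)) L P)
    (hk : KernelConditions k (extGammaIntensity α fun x => (β x : ℝ≥0∞))) :
    ∃ Γ : ℝ → Ω → ℝ, IsGammaProcess α Γ P ∧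
      ∀ᵐ ω ∂P, ∀ t, normalizedDF k L t ω = normalizedDF (fun t x => k t x / β x) Γ t ω := by
  have h0 := hL.measure_rate_eq_zero hβ
  have hmk := hk.measurable_kbar
  have hM := hL.isCompletelyRandom
  have hM' := hM.withDensity hβ fun f hf => levyExponent_extGamma_mul hβ h0 hf
  obtain ⟨Γ, hΓ, hΓM⟩ := hM'.exists_isIAP levyExponent_gamma_const_ne_top
  have hB : MeasurableSet {x | β x = 0} := hβ (measurableSet_singleton 0)
  have hnull : ∀ᵐ ω ∂P, (stieltjes fun y => L y ω) {x | β x = 0} = 0 := by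
    refine hM.ae_eq_zero hB (measure_mono_null ?_
      (map_fst_extGammaIntensity α (fun x => (β x : ℝ≥0∞)) h0 |> fun h => by
        rwa [Measure.map_apply measurable_fst hB] at h))
    exact fun p hp => hp.1
  refine ⟨Γ, hΓ, ?_⟩
  filter_upwards [hΓM, hnull] with ω h1 h2 t
  unfold normalizedDF drivenTotal
  rw [h1, lintegral_div_withDensity hβ h2 (hk.measurable t)]
  simp_rw [kbar_div hk]
  rw [lintegral_div_withDensity hβ h2 hmk]

end ScaledByRate

lemma measurable_normalizedDF_functional {k : ℝ → ℝ → ℝ≥0} (hk : ∀ t, Measurable (k t))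
    (hmk : Measurable (kbar k)) :
    Measurable fun (m : Measure ℝ) (t : ℝ) =>
      ((∫⁻ x, (k t x : ℝ≥0∞) ∂m) / ∫⁻ x, (kbar k x : ℝ≥0∞) ∂m).toReal :=
  measurable_pi_lambda _ fun t =>
    ((Measure.measurable_lintegral (hk t).coe_nnreal_ennreal).div
      (Measure.measurable_lintegral hmk.coe_nnreal_ennreal)).ennreal_toReal

/-- The random probability measure `k̄ dΓ / ∫ k̄ dΓ`. -/
noncomputable def normalizedWeighted {Ω : Type u} (k : ℝ → ℝ → ℝ≥0) (Γ : ℝ → Ω → ℝ)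
    (ω : Ω) : Measure ℝ :=
  (((stieltjes fun y => Γ y ω).withDensity fun x => (kbar k x : ℝ≥0∞)) univ)⁻¹ •
    (stieltjes fun y => Γ y ω).withDensity fun x => (kbar k x : ℝ≥0∞)

lemma normalizedDF_eq_integral {Ω : Type u} {k : ℝ → ℝ → ℝ≥0} {ν : Measure (ℝ × ℝ)}
    (hk : KernelConditions k ν) (Γ : ℝ → Ω → ℝ) (t : ℝ) (ω : Ω) :
    normalizedDF k Γ t ω = ∫ x, (k t x : ℝ) / kbar k x ∂normalizedWeighted k Γ ω :=
  hk.toReal_div_eq_integral _ t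

section GammaDriven

variable {Ω : Type u} [MeasurableSpace Ω] {P : Measure Ω} [IsProbabilityMeasure P]
  {α : Measure ℝ} [IsFiniteMeasure α] {k : ℝ → ℝ → ℝ≥0}

/-- Multiplying a gamma random measure by `k̄` gives jumps of rate `1 / k̄`. -/
lemma levyExponent_gamma_mul_kbar (hmk : Measurable (kbar k)) {f : ℝ → ℝ≥0} (hf : Measurable f) :
    levyExponent (gammaIntensity α) (fun x => ((f x * kbar k x : ℝ≥0) : ℝ≥0∞)) =
      levyExponent (extGammaIntensity α fun x => (kbar k x : ℝ≥0∞)⁻¹) fun x => f x := by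
  rw [levyExponent_gamma (by fun_prop), levyExponent_extGamma α (by fun_prop)
    hf.coe_nnreal_ennreal]
  exact lintegral_congr fun x => (gammaExponent_inv _ _).symm

lemma levyExponent_extGamma_inv_kbar_ne_top (hk : KernelConditions k (gammaIntensity α))
    (r : ℝ≥0) :
    levyExponent (extGammaIntensity α fun x => (kbar k x : ℝ≥0∞)⁻¹) (fun _ => r) ≠ ⊤ := by
  rw [← levyExponent_gamma_mul_kbar hk.measurable_kbar measurable_const]
  rcases eq_or_ne r 0 with rfl | hr
  · simp
  · simpa using hk.levyExponent_ne_top (pos_iff_ne_zero.2 hr)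

/-- The total mass of an extended gamma random measure of rate `1 / k̄` is almost surely positive
and finite. -/
lemma IsCompletelyRandom.ae_univ (hk : KernelConditions k (gammaIntensity α)) {N : Ω → Measure ℝ}
    (hN : IsCompletelyRandom (extGammaIntensity α fun x => (kbar k x : ℝ≥0∞)⁻¹) N P) :
    ∀ᵐ ω ∂P, N ω univ ≠ 0 ∧ N ω univ ≠ ⊤ := by
  have hmk := hk.measurable_kbar
  have hB := measurableSet_pos_kbar hmk
  have h1 := hN.ae_lintegral_lt_top (f := fun _ => 1) measurable_const
    (levyExponent_extGamma_inv_kbar_ne_top hk 1)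
  have h2 := hN.ae_ne_zero hB (by
    rw [extGammaIntensity_prod_Ioi (by fun_prop) hB fun x hx =>
      ENNReal.inv_ne_top.2 (ENNReal.coe_ne_zero.2 (ne_of_gt hx)), ← gammaIntensity_prod_Ioi hB,
      ← setOf_pos_kbar_eq]
    exact hk.infinite)
  filter_upwards [h1, h2] with ω h1 h2
  exact ⟨fun h => h2 (measure_mono_null (subset_univ _) h), by simpa using h1.ne⟩

/-- Almost sure properties of the paths of an extended gamma process of rate `1 / k̄`. -/
lemma IsExtGammaProcess.ae_normalized (hk : KernelConditions k (gammaIntensity α))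
    {G : ℝ → Ω → ℝ} (hG : IsExtGammaProcess α (fun x => (kbar k x : ℝ≥0∞)⁻¹) G P) :
    ∀ᵐ ω ∂P, Tendsto (fun x => G x ω) atTop (𝓝 (totalMass G ω)) ∧ 0 < totalMass G ω ∧
      stieltjes (fun y => normalizedProcess G y ω) =
        (stieltjes (fun y => G y ω) univ)⁻¹ • stieltjes (fun y => G y ω) := by
  filter_upwards [hG.isCompletelyRandom.ae_univ hk, IsIAP.ae_isIncreasingPath hG] with ω h1 h2
  refine ⟨?_, ?_, stieltjes_normalizedProcess h2 h1.2 h1.1⟩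
  · rw [totalMass_eq h2 h1.2]
    exact tendsto_of_stieltjes_univ h2 h1.2
  · rw [totalMass_eq h2 h1.2]
    exact ENNReal.toReal_pos h1.1 h1.2

variable {Γ : ℝ → Ω → ℝ}

lemma IsGammaProcess.isCompletelyRandom_withDensity (hΓ : IsGammaProcess α Γ P)
    (hk : KernelConditions k (gammaIntensity α)) :
    IsCompletelyRandom (extGammaIntensity α fun x => (kbar k x : ℝ≥0∞)⁻¹)
      (fun ω => (stieltjes fun y => Γ y ω).withDensity fun x => (kbar k x : ℝ≥0∞)) P :=
  hΓ.isCompletelyRandom.withDensity hk.measurable_kbar fun _ hf =>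
    levyExponent_gamma_mul_kbar hk.measurable_kbar hf

lemma IsGammaProcess.ae_isProbabilityMeasure (hΓ : IsGammaProcess α Γ P)
    (hk : KernelConditions k (gammaIntensity α)) :
    ∀ᵐ ω ∂P, IsProbabilityMeasure (normalizedWeighted k Γ ω) := by
  filter_upwards [(hΓ.isCompletelyRandom_withDensity hk).ae_univ hk] with ω hω
  refine ⟨?_⟩
  rw [normalizedWeighted, Measure.smul_apply, smul_eq_mul, ENNReal.inv_mul_cancel hω.1 hω.2]

/-- The extended gamma process `∫ k̄ dΓ`. -/
lemma IsGammaProcess.exists_extGammaProcess (hΓ : IsGammaProcess α Γ P)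
    (hk : KernelConditions k (gammaIntensity α)) :
    ∃ G : ℝ → Ω → ℝ, IsExtGammaProcess α (fun x => (kbar k x : ℝ≥0∞)⁻¹) G P ∧
      ∀ᵐ ω ∂P, Tendsto (fun x => G x ω) atTop (𝓝 (totalMass G ω)) ∧ 0 < totalMass G ω ∧
        stieltjes (fun y => normalizedProcess G y ω) = normalizedWeighted k Γ ω := by
  obtain ⟨G, hG, hGM⟩ := (hΓ.isCompletelyRandom_withDensity hk).exists_isIAP
    (levyExponent_extGamma_inv_kbar_ne_top hk)
  refine ⟨G, hG, ?_⟩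
  filter_upwards [IsExtGammaProcess.ae_normalized hk hG, hGM] with ω h1 h2
  exact ⟨h1.1, h1.2.1, by rw [h1.2.2, h2, normalizedWeighted]⟩

/-- Functionals of `k̄ dΓ / ∫ k̄ dΓ` have the same law as those of any normalized extended gamma
process of rate `1 / k̄`. -/
lemma IsGammaProcess.identDistrib_normalizedProcess (hΓ : IsGammaProcess α Γ P)
    (hk : KernelConditions k (gammaIntensity α)) {Ω' : Type v} [MeasurableSpace Ω']
    {P' : Measure Ω'} [IsProbabilityMeasure P'] {G : ℝ → Ω' → ℝ}
    (hG : IsExtGammaProcess α (fun x => (kbar k x : ℝ≥0∞)⁻¹) G P')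
    {γ : Type*} [MeasurableSpace γ] {Φ : Measure ℝ → γ} (hΦ : Measurable Φ) {X : Ω → γ}
    (hX : ∀ᵐ ω ∂P, X ω = Φ (normalizedWeighted k Γ ω)) :
    IdentDistrib X (fun ω => Φ (stieltjes fun y => normalizedProcess G y ω)) P P' := by
  have hN := hΓ.isCompletelyRandom_withDensity hk
  have hN' := hG.isCompletelyRandom
  refine identDistrib_of_map_eq hN.aemeasurable hN'.aemeasurable (hN.map_eq hN')
    (hΦ.comp measurable_normalize) hX ?_
  filter_upwards [hG.ae_normalized hk] with ω hω
  rw [hω.2.2]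
  rfl

lemma gammaIntensity_ne_zero (hk : KernelConditions k (gammaIntensity α)) : α ≠ 0 := by
  rintro rfl
  have := hk.infinite
  rw [setOf_pos_kbar_eq, gammaIntensity_prod_Ioi (measurableSet_pos_kbar hk.measurable_kbar)]
    at this
  simp at this

/-- For constant `k̄`, the normalized random measure is a Dirichlet random probability. -/
lemma IsGammaProcess.exists_dirichlet (hΓ : IsGammaProcess α Γ P)
    (hk : KernelConditions k (gammaIntensity α)) {b : ℝ≥0} (hb : 0 < b)
    (hkb : ∀ x, kbar k x = b⁻¹) : ∃ D : ℝ → Ω → ℝ, IsDirichletDF α D P ∧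
      ∀ᵐ ω ∂P, stieltjes (fun y => D y ω) = normalizedWeighted k Γ ω := by
  obtain ⟨D, hD, hDM⟩ := hΓ.isCompletelyRandom.exists_isDirichletDF (gammaIntensity_ne_zero hk)
  refine ⟨D, hD, hDM.mono fun ω hω => ?_⟩
  have hb' : (b : ℝ≥0∞) ≠ 0 := ENNReal.coe_ne_zero.2 hb.ne'
  rw [hω, normalizedWeighted]
  simp_rw [hkb, ENNReal.coe_inv hb.ne']
  rw [withDensity_const, Measure.smul_apply, smul_smul, smul_eq_mul,
    ENNReal.mul_inv (Or.inl (by simp)) (Or.inl (by simpa using hb')), inv_inv, mul_right_comm,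
    ENNReal.mul_inv_cancel hb' ENNReal.coe_ne_top, one_mul]

/-- For constant `k̄`, functionals of the normalized random measure have the same law as those of
any Dirichlet random distribution function. -/
lemma IsGammaProcess.identDistrib_dirichlet (hΓ : IsGammaProcess α Γ P)
    (hk : KernelConditions k (gammaIntensity α)) {b : ℝ≥0} (hb : 0 < b)
    (hkb : ∀ x, kbar k x = b⁻¹) {Ω' : Type v} [MeasurableSpace Ω']
    {P' : Measure Ω'} [IsProbabilityMeasure P'] {D : ℝ → Ω' → ℝ} (hD : IsDirichletDF α D P')
    {γ : Type*} [MeasurableSpace γ] {Φ : Measure ℝ → γ} (hΦ : Measurable Φ) {X : Ω → γ}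
    (hX : ∀ᵐ ω ∂P, X ω = Φ (normalizedWeighted k Γ ω)) :
    IdentDistrib X (fun ω => Φ (stieltjes fun y => D y ω)) P P' := by
  obtain ⟨D₀, hD₀, hD₀M⟩ := hΓ.exists_dirichlet hk hb hkb
  refine identDistrib_of_map_eq hD₀.aemeasurable_stieltjes hD.aemeasurable_stieltjes
    (hD₀.map_eq hD) hΦ ?_ (ae_of_all _ fun _ => rfl)
  filter_upwards [hX, hD₀M] with ω h1 h2
  rw [h1, h2]

lemma measurable_mixture_functional {ν : Measure (ℝ × ℝ)} (hk : KernelConditions k ν) :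
    Measurable fun (m : Measure ℝ) (t : ℝ) => ∫ x, (k t x : ℝ) / kbar k x ∂m :=
  measurable_pi_lambda _ fun t => by
    have hmk := hk.measurable_kbar
    have hmt := hk.measurable t
    exact measurable_integral_measure (by fun_prop)

/-- The mean of the normalized random distribution function as a mean of the random measure
`k̄ dΓ / ∫ k̄ dΓ`. -/
lemma IsGammaProcess.ae_mean (hΓ : IsGammaProcess α Γ P)
    (hk : KernelConditions k (gammaIntensity α))
    (hac : ∀ x a b, AbsolutelyContinuousOnInterval (fun t => (k t x : ℝ)) a b) {g : ℝ → ℝ}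
    (hi : ∀ᵐ ω ∂P, Integrable g (stieltjes fun t => normalizedDF k Γ t ω)) :
    ∀ᵐ ω ∂P, Integrable (fun x => (kbar k x : ℝ)⁻¹ * meanKernel k g x)
        (normalizedWeighted k Γ ω) ∧
      ∫ t, g t ∂(stieltjes fun t => normalizedDF k Γ t ω) =
        ∫ x, (kbar k x : ℝ)⁻¹ * meanKernel k g x ∂normalizedWeighted k Γ ω := by
  filter_upwards [hi, hΓ.ae_isProbabilityMeasure hk] with ω h1 _
  simp_rw [normalizedDF_eq_integral hk] at h1 ⊢
  exact integral_stieltjes_mixture hk hac _ h1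

end GammaDriven

theorem proposition3 {Ω : Type u} [MeasurableSpace Ω] (P : Measure Ω) [IsProbabilityMeasure P]
    (α : Measure ℝ) [IsFiniteMeasure α] (k : ℝ → ℝ → ℝ≥0) :
    -- (i)
    (∀ (β : ℝ → ℝ≥0) (L : ℝ → Ω → ℝ), Measurable β →
      IsExtGammaProcess α (fun x => (β x : ℝ≥0∞)) L P →
      KernelConditions k (extGammaIntensity α fun x => (β x : ℝ≥0∞)) →
      KernelConditions (fun t x => k t x / β x) (gammaIntensity α) ∧
      (∀ x, kbar (fun t x => k t x / β x) x = kbar k x / β x) ∧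
      (∀ᵐ ω ∂P, 0 < drivenTotal k L ω ∧ drivenTotal k L ω < ⊤) ∧
      (∃ Γ : ℝ → Ω → ℝ, IsGammaProcess α Γ P ∧
        ∀ᵐ ω ∂P, 0 < drivenTotal (fun t x => k t x / β x) Γ ω ∧
          drivenTotal (fun t x => k t x / β x) Γ ω < ⊤ ∧
          ∀ t, normalizedDF k L t ω = normalizedDF (fun t x => k t x / β x) Γ t ω) ∧
      (∀ (Ω' : Type v) [MeasurableSpace Ω'] (P' : Measure Ω') [IsProbabilityMeasure P']
        (Γ : ℝ → Ω' → ℝ), IsGammaProcess α Γ P' →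
        IdentDistrib (fun ω t => normalizedDF k L t ω)
          (fun ω t => normalizedDF (fun t x => k t x / β x) Γ t ω) P P')) ∧
    (∀ Γ : ℝ → Ω → ℝ, IsGammaProcess α Γ P → KernelConditions k (gammaIntensity α) →
      -- (ii)
      ((∀ᵐ ω ∂P, 0 < drivenTotal k Γ ω ∧ drivenTotal k Γ ω < ⊤) ∧
       (∃ G : ℝ → Ω → ℝ, IsExtGammaProcess α (fun x => (kbar k x : ℝ≥0∞)⁻¹) G P ∧
        ∀ᵐ ω ∂P, Tendsto (fun x => G x ω) atTop (𝓝 (totalMass G ω)) ∧ 0 < totalMass G ω ∧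
          ∀ t, normalizedDF k Γ t ω =
            ∫ x, (k t x : ℝ) / kbar k x ∂(stieltjes fun y => normalizedProcess G y ω)) ∧
       (∀ (Ω' : Type v) [MeasurableSpace Ω'] (P' : Measure Ω') [IsProbabilityMeasure P']
        (G : ℝ → Ω' → ℝ), IsExtGammaProcess α (fun x => (kbar k x : ℝ≥0∞)⁻¹) G P' →
        IdentDistrib (fun ω t => normalizedDF k Γ t ω)
          (fun ω t => ∫ x, (k t x : ℝ) / kbar k x ∂(stieltjes fun y => normalizedProcess G y ω))
          P P') ∧
       (∀ b : ℝ≥0, 0 < b → (∀ x, kbar k x = b⁻¹) →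
        (∃ D : ℝ → Ω → ℝ,
          IsMDP α (fun t x => (b : ℝ) * k t x) D (fun t ω => normalizedDF k Γ t ω) P) ∧
        (∀ (Ω' : Type v) [MeasurableSpace Ω'] (P' : Measure Ω') [IsProbabilityMeasure P']
          (D : ℝ → Ω' → ℝ), IsDirichletDF α D P' →
          IdentDistrib (fun ω t => normalizedDF k Γ t ω)
            (fun ω t => ∫ x, (b : ℝ) * k t x ∂(stieltjes fun y => D y ω)) P P'))) ∧
      -- (iii)
      ((∀ x a b, AbsolutelyContinuousOnInterval (fun t => (k t x : ℝ)) a b) →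
       ∀ g : ℝ → ℝ, Measurable g →
       (∀ᵐ ω ∂P, Integrable g (stieltjes fun t => normalizedDF k Γ t ω)) →
       (∃ G : ℝ → Ω → ℝ, IsExtGammaProcess α (fun x => (kbar k x : ℝ≥0∞)⁻¹) G P ∧
        ∀ᵐ ω ∂P, Tendsto (fun x => G x ω) atTop (𝓝 (totalMass G ω)) ∧ 0 < totalMass G ω ∧
          Integrable (fun x => (kbar k x : ℝ)⁻¹ * meanKernel k g x)
            (stieltjes fun y => normalizedProcess G y ω) ∧
          ∫ t, g t ∂(stieltjes fun t => normalizedDF k Γ t ω) =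
            ∫ x, (kbar k x : ℝ)⁻¹ * meanKernel k g x
              ∂(stieltjes fun y => normalizedProcess G y ω)) ∧
       (∀ (Ω' : Type v) [MeasurableSpace Ω'] (P' : Measure Ω') [IsProbabilityMeasure P']
        (G : ℝ → Ω' → ℝ), IsExtGammaProcess α (fun x => (kbar k x : ℝ≥0∞)⁻¹) G P' →
        IdentDistrib (fun ω => ∫ t, g t ∂(stieltjes fun t => normalizedDF k Γ t ω))
          (fun ω => ∫ x, (kbar k x : ℝ)⁻¹ * meanKernel k g x
            ∂(stieltjes fun y => normalizedProcess G y ω)) P P') ∧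
       (∀ b : ℝ≥0, 0 < b → (∀ x, kbar k x = b⁻¹) →
        (∃ D : ℝ → Ω → ℝ, IsDirichletDF α D P ∧
          ∀ᵐ ω ∂P, Integrable (fun x => (b : ℝ) * meanKernel k g x)
              (stieltjes fun y => D y ω) ∧
            ∫ t, g t ∂(stieltjes fun t => normalizedDF k Γ t ω) =
              ∫ x, (b : ℝ) * meanKernel k g x ∂(stieltjes fun y => D y ω)) ∧
        (∀ (Ω' : Type v) [MeasurableSpace Ω'] (P' : Measure Ω') [IsProbabilityMeasure P']
          (D : ℝ → Ω' → ℝ), IsDirichletDF α D P' →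
          IdentDistrib (fun ω => ∫ t, g t ∂(stieltjes fun t => normalizedDF k Γ t ω))
            (fun ω => ∫ x, (b : ℝ) * meanKernel k g x ∂(stieltjes fun y => D y ω)) P P')))) := by
  refine ⟨fun β L hβ hL hk => ?_, fun Γ hΓ hk => ⟨⟨?_, ?_, ?_, fun b hb hkb => ⟨?_, ?_⟩⟩,
    fun hac g hg hi => ⟨?_, ?_, fun b hb hkb => ⟨?_, ?_⟩⟩⟩⟩
  · have h0 := hL.measure_rate_eq_zero hβ
    have hk' := hk.div hβ h0
    obtain ⟨Γ, hΓ, hΓL⟩ := exists_gammaProcess_of_extGamma hβ hL hk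
    refine ⟨hk', kbar_div hk, hL.isCompletelyRandom.ae_drivenTotal hk, ⟨Γ, hΓ, ?_⟩, ?_⟩
    · filter_upwards [hΓL, hΓ.isCompletelyRandom.ae_drivenTotal hk'] with ω h1 h2
      exact ⟨h2.1, h2.2, h1⟩
    -- `F` is a functional of the gamma process just found, and all gamma measures have one law
    · intro Ω' _ P' _ Γ' hΓ'
      refine identDistrib_of_map_eq hΓ.isCompletelyRandom.aemeasurable
        hΓ'.isCompletelyRandom.aemeasurable
        (hΓ.isCompletelyRandom.map_eq hΓ'.isCompletelyRandom)
        (measurable_normalizedDF_functional hk'.measurable hk'.measurable_kbar) ?_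
        (ae_of_all _ fun ω => rfl)
      filter_upwards [hΓL] with ω hω
      exact funext hω
  · exact hΓ.isCompletelyRandom.ae_drivenTotal hk
  · obtain ⟨G, hG, hGM⟩ := hΓ.exists_extGammaProcess hk
    refine ⟨G, hG, hGM.mono fun ω hω => ⟨hω.1, hω.2.1, fun t => ?_⟩⟩
    rw [hω.2.2, normalizedDF_eq_integral hk]
  · intro Ω' _ P' _ G hG
    exact hΓ.identDistrib_normalizedProcess hk hG (measurable_mixture_functional hk)
      (ae_of_all _ fun ω => funext fun t => normalizedDF_eq_integral hk Γ t ω)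
  · have hbk : ∀ t x, (b : ℝ) * k t x = (k t x : ℝ) / kbar k x := fun t x => by
      rw [hkb, NNReal.coe_inv, div_inv_eq_mul, mul_comm]
    obtain ⟨D, hD, hDM⟩ := hΓ.exists_dirichlet hk hb hkb
    refine ⟨D, fun t => ?_, fun x => ?_, hD, hDM.mono fun ω hω t => ?_⟩
    · have := hk.measurable t
      fun_prop
    · have h1 := isIncreasingPath_normalizedKernel hk x
      simp_rw [hbk]
      refine ⟨h1.1, h1.2.1, h1.2.2, ?_⟩
      have h2 := ((NNReal.continuous_coe.tendsto _).comp (hk.tendsto_kbar x)).div_const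
        (kbar k x : ℝ)
      rwa [div_self (by rw [hkb]; positivity)] at h2
    · simp_rw [hω, hbk]
      exact normalizedDF_eq_integral hk Γ t ω
  · intro Ω' _ P' _ D hD
    have hbk : ∀ t x, (b : ℝ) * k t x = (k t x : ℝ) / kbar k x := fun t x => by
      rw [hkb, NNReal.coe_inv, div_inv_eq_mul, mul_comm]
    simp_rw [hbk]
    exact hΓ.identDistrib_dirichlet hk hb hkb hD (measurable_mixture_functional hk)
      (ae_of_all _ fun ω => funext fun t => normalizedDF_eq_integral hk Γ t ω)
  · obtain ⟨G, hG, hGM⟩ := hΓ.exists_extGammaProcess hk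
    refine ⟨G, hG, ?_⟩
    filter_upwards [hGM, hΓ.ae_mean hk hac hi] with ω h1 h2
    rw [h1.2.2]
    exact ⟨h1.1, h1.2.1, h2.1, h2.2⟩
  · intro Ω' _ P' _ G hG
    exact hΓ.identDistrib_normalizedProcess hk hG
      (measurable_integral_measure (measurable_inv_kbar_mul_meanKernel hk hac hg))
      ((hΓ.ae_mean hk hac hi).mono fun ω h => h.2)
  · obtain ⟨D, hD, hDM⟩ := hΓ.exists_dirichlet hk hb hkb
    have hbk : ∀ x, (b : ℝ) = (kbar k x : ℝ)⁻¹ := fun x => by rw [hkb, NNReal.coe_inv, inv_inv]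
    refine ⟨D, hD, ?_⟩
    filter_upwards [hDM, hΓ.ae_mean hk hac hi] with ω h1 h2
    simp_rw [h1, show ∀ x, (b : ℝ) * meanKernel k g x = (kbar k x : ℝ)⁻¹ * meanKernel k g x from
      fun x => by rw [← hbk x]]
    exact h2
  · intro Ω' _ P' _ D hD
    simp_rw [show ∀ x, (b : ℝ) * meanKernel k g x = (kbar k x : ℝ)⁻¹ * meanKernel k g x from
      fun x => by rw [hkb, NNReal.coe_inv, inv_inv]]
    exact hΓ.identDistrib_dirichlet hk hb hkb hD
      (measurable_integral_measure (measurable_inv_kbar_mul_meanKernel hk hac hg))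
      ((hΓ.ae_mean hk hac hi).mono fun ω h => h.2)
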